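/- Let $F$ be Thompson's group of all piecewise linear homeomorphisms of $[0,1]$ with finitely many breakpoints, all dyadic, and with all slopes integer powers of $2$. It acts on the set of dyadic numbers in $[0,1]$; products in $F$ are compositions. Let $a,b\in F$ be the standard generators $$a(t)=\begin{cases}t/2,&t\le\frac12\\ t-\frac14,&\frac12\le t\le\frac34\\ 2t-1,&t\ge\frac34\end{cases}\qquad b(t)=\begin{cases}t,&t\le\frac12\\ \frac t2+\frac14,&\frac12\le t\le\frac34\\ t-\frac18,&\frac34\le t\le\frac78\\ 2t-1,&t\ge\frac78.\end{cases}$$ Let $\mathcal H$ be the Schreier graph, with respect to $\{a,b\}$, of the action of $F$ on the orbit of $p=1/2$, let $d$ be its graph distance, $B(x,n)=\{y: d(x,y)\le n\}$, $\partial B(x,n)=\{y:d(x,y)=n\}$, and let $|g|$ be the word length of $g\in F$ with respect to $\{a^{\pm1},b^{\pm1}\}$. Call $g\in F$ a geodesic (from $p$ to $g(p)$) if $|g|=d(p,g(p))$. The cone type $C(x)$ of a vertex $x$ is the set of all $g\in F$ such that for every geodesic $w$ with $w(p)=x$ the element $gw$ is a geodesic with $|gw|=|g|+|w|$. The orbit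 of $1/2$ is the set of dyadic numbers in $(0,1)$, and every geodesic $g$ is represented by exactly one word of length $|g|$ in $a^{\pm1},b^{\pm1}$. Call a vertex $x$ black if $x<\frac12$, grey if $\frac12\le x<\frac34$, and white if $x\ge\frac34$. Every vertex has exactly one of the following types, each type occurs, and two vertices have the same cone type if and only if they are of the same type: type 0: $x=\frac12$; type 1: black vertices; type 2: grey vertices other than $\frac12$; type 3: white vertices adjacent to a grey vertex other than $\frac12$; type 4: the other white vertices. Thus there are exactly five cone types $C_0,\dots,C_4$. Put $\Lambda_i^n=\sum_{g\in C_i,\,|g|=n}g\in\mathbb Z[F]$ and, for a vertex $x_i$ of type $i$, $L_i^n=\#\{g(x_i): g\in C_i,\ |g|=n\}$, the number of end points of the geodesic continuations of length $n$ from $x_i$. Then $\Lambda_i^0=1$, $L_i^0=1$, and for $n\ge1$ $$\begin{aligned}\Lambda^n_0&=\Lambda^{n-1}_1a+\Lambda^{n-1}_3a^{-1}, & L^n_0&=L^{n-1}_1+L^{n-1}_3,\\ \Lambda^n_1&=\Lambda^{n-1}_1a, & L^n_1&=L^{n-1}_1,\\ \Lambda^n_2&=\Lambda^{n-1}_1a+\Lambda^{n-1}_2b+\Lambda^{n-1}_3a^{-1},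 & L^n_2&=L^{n-1}_1+L^{n-1}_2+L^{n-1}_3,\\ \Lambda^n_3&=\Lambda^{n-1}_2b+\Lambda^{n-1}_4(a^{-1}+b^{-1}), & L^n_3&=L^{n-1}_2+L^{n-1}_4,\\ \Lambda^n_4&=\Lambda^{n-1}_4(a^{-1}+b^{-1}), & L^n_4&=L^{n-1}_4.\end{aligned}$$ Let $\mathbf A$, $A$, $B$ be the transition matrices $$\mathbf A=\begin{pmatrix}0&a&0&a^{-1}&0\\0&a&0&0&0\\0&a&b&a^{-1}&0\\0&0&b&0&a^{-1}+b^{-1}\\0&0&0&0&a^{-1}+b^{-1}\end{pmatrix},\quad A=\begin{pmatrix}0&1&0&1&0\\0&1&0&0&0\\0&1&1&1&0\\0&0&1&0&2\\0&0&0&0&2\end{pmatrix},\quad B=\begin{pmatrix}0&1&0&1&0\\0&1&0&0&0\\0&1&1&1&0\\0&0&1&0&1\\0&0&0&0&1\end{pmatrix},$$ and let $\mathbf 1$ be the vector with all entries $1$. As formal power series in a central variable $z$, the row vector $\tilde L(z)=\sum_n(\Lambda_0^n,\dots,\Lambda_4^n)z^n$ is $\tilde L(z)=\mathbf 1^T(I-z\mathbf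 A^T)^{-1}$, where $I-z\mathbf A^T$ is invertible, and its first coordinate is the complete geodesic growth function $\sum_{g\text{ geodesic}}g\,z^{|g|}$. Moreover $$\Big(\sum_n\#\{g\in C_i:|g|=n\}z^n\Big)_{i=0}^4=(I-zA)^{-1}\mathbf 1=\Big(\tfrac1{1-2z},\tfrac1{1-z},\tfrac1{1-3z+2z^2},\tfrac1{1-3z+2z^2},\tfrac1{1-2z}\Big),$$ $$\Big(\sum_nL_i^nz^n\Big)_{i=0}^4=(I-zB)^{-1}\mathbf 1=\Big(\tfrac{1+z}{1-z-z^2},\tfrac1{1-z},\tfrac{1+z}{1-2z+z^3},\tfrac1{1-2z+z^3},\tfrac1{1-z}\Big).$$ Consequently the geodesic growth function is $l(z)=\sum_{g\text{ geodesic}}z^{|g|}=\frac1{1-2z}$, and, with $\varphi=\frac{1+\sqrt5}2$ and $\hat\varphi=\frac{1-\sqrt5}2$, the orbit growth function is $$\hat l(z)=\sum_{n\ge0}\#\{g(p): g\text{ geodesic},\ |g|=n\}\,z^n=\frac{1+z}{1-z-z^2}=\frac{\varphi^2}{\sqrt5(1-\varphi z)}-\frac{\hat\varphi^2}{\sqrt5(1-\hat\varphi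 z)}.$$ For all $n\ge0$, $$|\partial B(p,n)|=\frac{\varphi^{n+2}-\hat\varphi^{n+2}}{\sqrt5},\qquad |B(p,n)|=\frac{\varphi^{n+3}-\varphi^2}{\sqrt5(\varphi-1)}-\frac{\hat\varphi^{n+3}-\hat\varphi^2}{\sqrt5(\hat\varphi-1)}.$$ -/

import Mathlib

/-! ## Schreier graphs, geodesics and cone types -/

section Schreier

variable {G X : Type*} [Group G] [MulAction G X]

/-- The (undirected) Schreier graph of the action of `G` on `X` with respect to `S ⊆ G`: the
vertices `x` and `s • x` are joined for every `s ∈ S`. Loops and multiplicities of edges, which do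
not influence distances, are not recorded here; they are visible in the words below. -/
def schreierGraph (S : Set G) (X : Type*) [MulAction G X] : SimpleGraph X :=
  SimpleGraph.fromRel fun x y => ∃ s ∈ S, s • x = y

/-- The list `u = [s₁, …, sₙ]` of elements of `S ∪ S⁻¹` is a word for `g`, i.e. `g = s₁ ⋯ sₙ`. -/
def IsWordFor (S : Set G) (u : List G) (g : G) : Prop :=
  (∀ s ∈ u, s ∈ S ∨ s⁻¹ ∈ S) ∧ u.prod = g

/-- The word length `|g|` with respect to `S` (equal to `⊤` if `g` is not generated by `S`). -/
noncomputable def wordLength (S : Set G) (g : G) : ℕ∞ :=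
  ⨅ (u : List G) (_ : IsWordFor S u g), (u.length : ℕ∞)

/-- The sphere `∂B(x, n)` of a graph. -/
def graphSphere {V : Type*} (H : SimpleGraph V) (x : V) (n : ℕ) : Set V := {y | H.edist x y = n}

/-- The ball `B(x, n)` of a graph. -/
def graphBall {V : Type*} (H : SimpleGraph V) (x : V) (n : ℕ) : Set V := {y | H.edist x y ≤ n}

/-- `g` is a geodesic of length `n` from `p` to `g • p`:
both `|g|` and the distance from `p` to `g • p` in the Schreier graph are equal to `n`. -/
def IsGeodesicOfLength (S : Set G) (p : X) (g : G) (n : ℕ) : Prop :=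
  wordLength S g = n ∧ (schreierGraph S X).edist p (g • p) = n

/-- The cone type of `x` with respect to the base point `p`: all `g` such that every geodesic `w`
from `p` to `x`, followed by `g`, is a geodesic. The action is a left action, so
"`w` followed by `g`" is `g * w`; its length is the sum of the two lengths. -/
def coneType (S : Set G) (p x : X) : Set G :=
  {g | ∀ (w : G) (m : ℕ), IsGeodesicOfLength S p w m → w • p = x →
    ∃ n : ℕ, wordLength S g = n ∧ IsGeodesicOfLength S p (g * w) (n + m)}

/-- The elements of length `n` in the cone type of `x`. -/
def coneLevel (S : Set G) (p x : X) (n : ℕ) : Set G :=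
  {g | g ∈ coneType S p x ∧ wordLength S g = n}

/-- `Λⁿ = ∑ g`, the sum over the elements `g` of length `n` in the cone type of `x`,
in the group ring. -/
noncomputable def coneSum (S : Set G) (p x : X) (n : ℕ) : MonoidAlgebra ℤ G :=
  ∑ᶠ g ∈ coneLevel S p x n, MonoidAlgebra.of ℤ G g

/-- `Lⁿ`, the number of different points to which the elements of length `n` in the cone type
of `x` lead from `x`. -/
noncomputable def coneOrbitCount (S : Set G) (p x : X) (n : ℕ) : ℕ :=
  {y : X | ∃ g ∈ coneLevel S p x n, g • x = y}.ncard

/-- The complete geodesic growth function `∑ g z^|g|`, over all geodesics `g` starting at `p`. -/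
noncomputable def completeGeodesicGrowth (S : Set G) (p : X) : PowerSeries (MonoidAlgebra ℤ G) :=
  PowerSeries.mk fun n => ∑ᶠ g ∈ {g : G | IsGeodesicOfLength S p g n}, MonoidAlgebra.of ℤ G g

/-- The geodesic growth function `∑ z^|g|`, over all geodesics `g` starting at `p`. -/
noncomputable def geodesicGrowth (S : Set G) (p : X) : PowerSeries ℝ :=
  PowerSeries.mk fun n => ({g : G | IsGeodesicOfLength S p g n}.ncard : ℝ)

/-- The orbit growth function `∑ #{x : x = g • p for a geodesic g of length n} zⁿ`. -/
noncomputable def orbitGrowth (S : Set G) (p : X) : PowerSeries ℝ :=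
  PowerSeries.mk fun n => ({x : X | ∃ g : G, IsGeodesicOfLength S p g n ∧ g • p = x}.ncard : ℝ)

end Schreier

/-! ## Thompson's group `F` and its action on the dyadic numbers -/

namespace Thompson

open unitInterval

/-- Dyadic rational numbers. -/
def IsDyadic (x : ℝ) : Prop := ∃ (m : ℤ) (n : ℕ), x = m / 2 ^ n

theorem IsDyadic.add {x y : ℝ} (hx : IsDyadic x) (hy : IsDyadic y) : IsDyadic (x + y) := by
  obtain ⟨m, n, rfl⟩ := hx
  obtain ⟨m', n', rfl⟩ := hy
  refine ⟨m * 2 ^ n' + m' * 2 ^ n, n + n', ?_⟩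
  push_cast
  rw [pow_add]
  field_simp

theorem IsDyadic.sub {x y : ℝ} (hx : IsDyadic x) (hy : IsDyadic y) : IsDyadic (x - y) := by
  obtain ⟨m', n', rfl⟩ := hy
  rw [sub_eq_add_neg]
  exact hx.add ⟨-m', n', by push_cast; ring⟩

theorem IsDyadic.zpow_mul {x : ℝ} (hx : IsDyadic x) (k : ℤ) : IsDyadic ((2 : ℝ) ^ k * x) := by
  obtain ⟨m, n, rfl⟩ := hx
  obtain ⟨j, rfl | rfl⟩ := k.eq_nat_or_neg
  · exact ⟨2 ^ j * m, n, by push_cast; rw [zpow_natCast]; ring⟩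
  · exact ⟨m, j + n, by rw [zpow_neg, zpow_natCast, pow_add]; field_simp⟩

/-- `f` is affine with slope an integer power of `2` on every interval whose interior does not
meet `B`. -/
def IsAffineOff (B : Finset I) (f : I ≃ₜ I) : Prop :=
  ∀ t u : I, t < u → (∀ s ∈ B, ¬ (t < s ∧ s < u)) →
    ∃ k : ℤ, ∀ x ∈ Set.Icc t u, ∀ y ∈ Set.Icc t u, (f y : ℝ) - f x = 2 ^ k * ((y : ℝ) - x)

/-- `f` is piecewise linear with finitely many breakpoints, all of them dyadic, and all its slopes
are integer powers of `2`. -/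
def IsThompson (f : I ≃ₜ I) : Prop :=
  ∃ B : Finset I, (∀ s ∈ B, IsDyadic s) ∧ IsAffineOff B f

theorem IsAffineOff.key {B : Finset I} {f : I ≃ₜ I} (hB : ∀ s ∈ B, IsDyadic s)
    (h : IsAffineOff B f) (n : ℕ) : ∀ t u : I, t < u →
      (B.filter fun s => t < s ∧ s < u).card = n →
      f t < f u ∧ (IsDyadic t → IsDyadic u → IsDyadic ((f u : ℝ) - f t)) := by
  induction n using Nat.strong_induction_on with
  | _ n ih =>
    intro t u htu hc
    by_cases hs : ∃ s ∈ B, t < s ∧ s < u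
    · obtain ⟨s, hsB, hts, hsu⟩ := hs
      have h1 : (B.filter fun r => t < r ∧ r < s).card < n := by
        rw [← hc]
        refine Finset.card_lt_card (Finset.ssubset_iff_subset_ne.2 ⟨fun r hr => ?_, fun he => ?_⟩)
        · simp only [Finset.mem_filter] at hr ⊢
          exact ⟨hr.1, hr.2.1, hr.2.2.trans hsu⟩
        · have : s ∈ B.filter fun r => t < r ∧ r < s := by
            rw [he]; simp [hsB, hts, hsu]
          simp at this
      have h2 : (B.filter fun r => s < r ∧ r < u).card < n := by
        rw [← hc]
        refine Finset.card_lt_card (Finset.ssubset_iff_subset_ne.2 ⟨fun r hr => ?_, fun he => ?_⟩)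
        · simp only [Finset.mem_filter] at hr ⊢
          exact ⟨hr.1, hts.trans hr.2.1, hr.2.2⟩
        · have : s ∈ B.filter fun r => s < r ∧ r < u := by
            rw [he]; simp [hsB, hts, hsu]
          simp at this
      obtain ⟨a1, b1⟩ := ih _ h1 t s hts rfl
      obtain ⟨a2, b2⟩ := ih _ h2 s u hsu rfl
      refine ⟨a1.trans a2, fun ht hu => ?_⟩
      have := (b1 ht (hB s hsB)).add (b2 (hB s hsB) hu)
      convert this using 1
      ring
    · push Not at hs
      obtain ⟨k, hk⟩ := h t u htu fun s hsB hst => absurd hst.2 (not_lt.2 (hs s hsB hst.1))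
      have e := hk t ⟨le_rfl, htu.le⟩ u ⟨htu.le, le_rfl⟩
      refine ⟨?_, fun ht hu => ?_⟩
      · have : (0 : ℝ) < 2 ^ k * ((u : ℝ) - t) :=
          mul_pos (by positivity) (sub_pos.2 (Subtype.coe_lt_coe.2 htu))
        rw [← e] at this
        exact Subtype.coe_lt_coe.1 (sub_pos.1 this)
      · rw [e]
        exact (hu.sub ht).zpow_mul k

theorem IsThompson.strictMono {f : I ≃ₜ I} (h : IsThompson f) : StrictMono f := by
  obtain ⟨B, hB, h⟩ := h
  exact fun t u htu => (h.key hB _ t u htu rfl).1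

theorem IsThompson.map_zero {f : I ≃ₜ I} (h : IsThompson f) : f 0 = 0 := by
  obtain ⟨x, hx⟩ := f.surjective 0
  have : f 0 ≤ f x := h.strictMono.monotone unitInterval.nonneg'
  rw [hx] at this
  exact le_antisymm this unitInterval.nonneg'

theorem IsThompson.isDyadic {f : I ≃ₜ I} (h : IsThompson f) {t : I} (ht : IsDyadic t) :
    IsDyadic (f t) := by
  have h0 := h.map_zero
  obtain ⟨B, hB, h⟩ := h
  rcases eq_or_lt_of_le (unitInterval.nonneg' : 0 ≤ t) with rfl | hlt
  · rw [h0]; exact ht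
  · have := (h.key hB _ 0 t hlt rfl).2 ⟨0, 0, by simp⟩ ht
    rw [h0] at this
    simpa using this

theorem IsThompson.one : IsThompson 1 :=
  ⟨∅, by simp, fun _ _ _ _ => ⟨0, fun x _ y _ => by simp⟩⟩

theorem IsThompson.inv {f : I ≃ₜ I} (h : IsThompson f) : IsThompson f⁻¹ := by
  have hd := @IsThompson.isDyadic f h
  have hm := h.strictMono
  obtain ⟨B, hB, h⟩ := h
  have e : ∀ x, f (f⁻¹ x) = x := fun x => f.apply_symm_apply x
  refine ⟨B.image f, fun s hs => ?_, fun t u htu hno => ?_⟩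
  · obtain ⟨r, hr, rfl⟩ := Finset.mem_image.1 hs
    exact hd (hB r hr)
  · have l : ∀ {x y}, x ≤ y → f⁻¹ x ≤ f⁻¹ y := fun {x y} hxy => by
      rw [← hm.le_iff_le, e, e]; exact hxy
    obtain ⟨k, hk⟩ := h (f⁻¹ t) (f⁻¹ u) (by rw [← hm.lt_iff_lt, e, e]; exact htu)
      (fun s hs hst => hno (f s) (Finset.mem_image_of_mem f hs)
        ⟨by rw [← e t]; exact hm hst.1, by rw [← e u]; exact hm hst.2⟩)
    refine ⟨-k, fun x hx y hy => ?_⟩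
    have := hk (f⁻¹ x) ⟨l hx.1, l hx.2⟩ (f⁻¹ y) ⟨l hy.1, l hy.2⟩
    rw [e, e] at this
    rw [this, ← mul_assoc, ← zpow_add₀ (by norm_num)]
    simp

theorem IsThompson.mul {f g : I ≃ₜ I} (hf : IsThompson f) (hg : IsThompson g) :
    IsThompson (f * g) := by
  have hd := @IsThompson.isDyadic _ hg.inv
  have hm := hg.strictMono
  obtain ⟨B, hB, hf⟩ := hf
  obtain ⟨C, hC, hg⟩ := hg
  refine ⟨C ∪ B.image (g⁻¹ : I ≃ₜ I), fun s hs => ?_, fun t u htu hno => ?_⟩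
  · rcases Finset.mem_union.1 hs with hs | hs
    · exact hC s hs
    · obtain ⟨r, hr, rfl⟩ := Finset.mem_image.1 hs
      exact hd (hB r hr)
  · obtain ⟨k, hk⟩ := hg t u htu fun s hs => hno s (Finset.mem_union_left _ hs)
    obtain ⟨j, hj⟩ := hf (g t) (g u) (hm htu) fun s hs hst =>
      hno (g⁻¹ s) (Finset.mem_union_right _ (Finset.mem_image_of_mem _ hs)) (by
        have e' : g (g⁻¹ s) = s := g.apply_symm_apply s
        exact ⟨hm.lt_iff_lt.1 (by rw [e']; exact hst.1), hm.lt_iff_lt.1 (by rw [e']; exact hst.2)⟩)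
    refine ⟨j + k, fun x hx y hy => ?_⟩
    have h1 := hk x hx y hy
    have h2 := hj (g x) ⟨hm.monotone hx.1, hm.monotone hx.2⟩ (g y)
      ⟨hm.monotone hy.1, hm.monotone hy.2⟩
    rw [h1] at h2
    rw [zpow_add₀ (by norm_num), mul_assoc]
    exact h2

/-- Thompson's group `F`, as a group of homeomorphisms of `[0, 1]` (the product is composition). -/
def F : Subgroup (I ≃ₜ I) where
  carrier := {f | IsThompson f}
  mul_mem' := IsThompson.mul
  one_mem' := IsThompson.one
  inv_mem' := IsThompson.inv

/-- The dyadic numbers in `[0, 1]`. -/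
abbrev Dyadics : Type := {t : I // IsDyadic t}

/-- The natural action of `F` on the dyadic numbers in `[0, 1]`. -/
instance : MulAction F Dyadics where
  smul f t := ⟨f.1 t.1, IsThompson.isDyadic f.2 t.2⟩
  one_smul _ := rfl
  mul_smul _ _ _ := rfl

/-- The homeomorphism `t ↦ t/2` on `[0,1/2]`, `t - 1/4` on `[1/2,3/4]`, `2t - 1` on `[3/4,1]`. -/
noncomputable def aHomeo : I ≃ₜ I where
  toFun t := ⟨if (t : ℝ) ≤ 1 / 2 then t / 2 else if (t : ℝ) ≤ 3 / 4 then t - 1 / 4 else 2 * t - 1,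
    by have h0 := t.2.1; have h1 := t.2.2; split_ifs <;> constructor <;> linarith⟩
  invFun t := ⟨if (t : ℝ) ≤ 1 / 4 then 2 * t else if (t : ℝ) ≤ 1 / 2 then t + 1 / 4 else (t + 1) / 2,
    by have h0 := t.2.1; have h1 := t.2.2; split_ifs <;> constructor <;> linarith⟩
  left_inv t := by
    apply Subtype.ext
    dsimp only
    split_ifs <;> linarith
  right_inv t := by
    apply Subtype.ext
    dsimp only
    split_ifs <;> linarith
  continuous_toFun := by
    refine Continuous.subtype_mk (Continuous.if_le (by fun_prop) (Continuous.if_le (by fun_prop)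
      (by fun_prop) (by fun_prop) (by fun_prop) fun x hx => ?_) (by fun_prop) (by fun_prop)
      fun x hx => ?_) _
    · rw [hx]; norm_num
    · rw [hx]; norm_num
  continuous_invFun := by
    refine Continuous.subtype_mk (Continuous.if_le (by fun_prop) (Continuous.if_le (by fun_prop)
      (by fun_prop) (by fun_prop) (by fun_prop) fun x hx => ?_) (by fun_prop) (by fun_prop)
      fun x hx => ?_) _
    · rw [hx]; norm_num
    · rw [hx]; norm_num

/-- The homeomorphism that is the identity on `[0,1/2]` and `t ↦ t/2 + 1/4` on `[1/2,3/4]`,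
`t - 1/8` on `[3/4,7/8]`, `2t - 1` on `[7/8,1]`. -/
noncomputable def bHomeo : I ≃ₜ I where
  toFun t := ⟨if (t : ℝ) ≤ 1 / 2 then t else if (t : ℝ) ≤ 3 / 4 then t / 2 + 1 / 4 else
      if (t : ℝ) ≤ 7 / 8 then t - 1 / 8 else 2 * t - 1,
    by have h0 := t.2.1; have h1 := t.2.2; split_ifs <;> constructor <;> linarith⟩
  invFun t := ⟨if (t : ℝ) ≤ 1 / 2 then t else if (t : ℝ) ≤ 5 / 8 then 2 * t - 1 / 2 else
      if (t : ℝ) ≤ 3 / 4 then t + 1 / 8 else (t + 1) / 2,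
    by have h0 := t.2.1; have h1 := t.2.2; split_ifs <;> constructor <;> linarith⟩
  left_inv t := by
    apply Subtype.ext
    dsimp only
    split_ifs <;> linarith
  right_inv t := by
    apply Subtype.ext
    dsimp only
    split_ifs <;> linarith
  continuous_toFun := by
    refine Continuous.subtype_mk (Continuous.if_le (by fun_prop) (Continuous.if_le (by fun_prop)
      (Continuous.if_le (by fun_prop) (by fun_prop) (by fun_prop) (by fun_prop) fun x hx => ?_)
      (by fun_prop) (by fun_prop) fun x hx => ?_) (by fun_prop) (by fun_prop) fun x hx => ?_) _
    · rw [hx]; norm_num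
    · rw [hx]; norm_num
    · rw [hx]; norm_num
  continuous_invFun := by
    refine Continuous.subtype_mk (Continuous.if_le (by fun_prop) (Continuous.if_le (by fun_prop)
      (Continuous.if_le (by fun_prop) (by fun_prop) (by fun_prop) (by fun_prop) fun x hx => ?_)
      (by fun_prop) (by fun_prop) fun x hx => ?_) (by fun_prop) (by fun_prop) fun x hx => ?_) _
    · rw [hx]; norm_num
    · rw [hx]; norm_num
    · rw [hx]; norm_num

theorem isThompson_aHomeo : IsThompson aHomeo := by
  refine ⟨{⟨1 / 2, by norm_num, by norm_num⟩, ⟨3 / 4, by norm_num, by norm_num⟩}, ?_, ?_⟩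
  · simp only [Finset.mem_insert, Finset.mem_singleton, forall_eq_or_imp, forall_eq]
    exact ⟨⟨1, 1, by norm_num⟩, ⟨3, 2, by norm_num⟩⟩
  · intro t u _ h
    simp only [Finset.mem_insert, Finset.mem_singleton, forall_eq_or_imp, forall_eq,
      ← Subtype.coe_lt_coe, not_and, not_lt] at h
    obtain ⟨h1, h2⟩ := h
    rcases le_or_gt (u : ℝ) (1 / 2) with c1 | c1
    · refine ⟨-1, fun x hx y hy => ?_⟩
      have hx2 : (x : ℝ) ≤ u := hx.2
      have hy2 : (y : ℝ) ≤ u := hy.2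
      simp only [aHomeo, Homeomorph.homeomorph_mk_coe, Equiv.coe_fn_mk]
      split_ifs <;> norm_num <;> linarith
    have c1' : (1 / 2 : ℝ) ≤ t := not_lt.1 fun c => absurd c1 (not_lt.2 (h1 c))
    rcases le_or_gt (u : ℝ) (3 / 4) with c2 | c2
    · refine ⟨0, fun x hx y hy => ?_⟩
      have hx1 : (t : ℝ) ≤ x := hx.1
      have hy1 : (t : ℝ) ≤ y := hy.1
      have hx2 : (x : ℝ) ≤ u := hx.2
      have hy2 : (y : ℝ) ≤ u := hy.2
      simp only [aHomeo, Homeomorph.homeomorph_mk_coe, Equiv.coe_fn_mk]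
      split_ifs <;> norm_num <;> linarith
    have c2' : (3 / 4 : ℝ) ≤ t := not_lt.1 fun c => absurd c2 (not_lt.2 (h2 c))
    refine ⟨1, fun x hx y hy => ?_⟩
    have hx1 : (t : ℝ) ≤ x := hx.1
    have hy1 : (t : ℝ) ≤ y := hy.1
    simp only [aHomeo, Homeomorph.homeomorph_mk_coe, Equiv.coe_fn_mk]
    split_ifs <;> norm_num <;> linarith

theorem isThompson_bHomeo : IsThompson bHomeo := by
  refine ⟨{⟨1 / 2, by norm_num, by norm_num⟩, ⟨3 / 4, by norm_num, by norm_num⟩,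
    ⟨7 / 8, by norm_num, by norm_num⟩}, ?_, ?_⟩
  · simp only [Finset.mem_insert, Finset.mem_singleton, forall_eq_or_imp, forall_eq]
    exact ⟨⟨1, 1, by norm_num⟩, ⟨3, 2, by norm_num⟩, ⟨7, 3, by norm_num⟩⟩
  · intro t u _ h
    simp only [Finset.mem_insert, Finset.mem_singleton, forall_eq_or_imp, forall_eq,
      ← Subtype.coe_lt_coe, not_and, not_lt] at h
    obtain ⟨h1, h2, h3⟩ := h
    rcases le_or_gt (u : ℝ) (1 / 2) with c1 | c1
    · refine ⟨0, fun x hx y hy => ?_⟩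
      have hx2 : (x : ℝ) ≤ u := hx.2
      have hy2 : (y : ℝ) ≤ u := hy.2
      simp only [bHomeo, Homeomorph.homeomorph_mk_coe, Equiv.coe_fn_mk]
      split_ifs <;> norm_num <;> linarith
    have c1' : (1 / 2 : ℝ) ≤ t := not_lt.1 fun c => absurd c1 (not_lt.2 (h1 c))
    rcases le_or_gt (u : ℝ) (3 / 4) with c2 | c2
    · refine ⟨-1, fun x hx y hy => ?_⟩
      have hx1 : (t : ℝ) ≤ x := hx.1
      have hy1 : (t : ℝ) ≤ y := hy.1
      have hx2 : (x : ℝ) ≤ u := hx.2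
      have hy2 : (y : ℝ) ≤ u := hy.2
      simp only [bHomeo, Homeomorph.homeomorph_mk_coe, Equiv.coe_fn_mk]
      split_ifs <;> norm_num <;> linarith
    have c2' : (3 / 4 : ℝ) ≤ t := not_lt.1 fun c => absurd c2 (not_lt.2 (h2 c))
    rcases le_or_gt (u : ℝ) (7 / 8) with c3 | c3
    · refine ⟨0, fun x hx y hy => ?_⟩
      have hx1 : (t : ℝ) ≤ x := hx.1
      have hy1 : (t : ℝ) ≤ y := hy.1
      have hx2 : (x : ℝ) ≤ u := hx.2
      have hy2 : (y : ℝ) ≤ u := hy.2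
      simp only [bHomeo, Homeomorph.homeomorph_mk_coe, Equiv.coe_fn_mk]
      split_ifs <;> norm_num <;> linarith
    have c3' : (7 / 8 : ℝ) ≤ t := not_lt.1 fun c => absurd c3 (not_lt.2 (h3 c))
    refine ⟨1, fun x hx y hy => ?_⟩
    have hx1 : (t : ℝ) ≤ x := hx.1
    have hy1 : (t : ℝ) ≤ y := hy.1
    simp only [bHomeo, Homeomorph.homeomorph_mk_coe, Equiv.coe_fn_mk]
    split_ifs <;> norm_num <;> linarith

/-- The first standard generator of `F`. -/
noncomputable def a : F := ⟨aHomeo, isThompson_aHomeo⟩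

/-- The second standard generator of `F`. -/
noncomputable def b : F := ⟨bHomeo, isThompson_bHomeo⟩

/-- The standard generating set of `F`. -/
def gens : Set F := {a, b}

/-- The dyadic number `1/2`. -/
noncomputable def half : Dyadics := ⟨⟨1 / 2, by norm_num, by norm_num⟩, 1, 1, by norm_num⟩

/-- The vertices of `𝓗`: the orbit of `1/2`. -/
abbrev Vertex : Type := MulAction.orbit F half

/-- The base point `1/2`. -/
noncomputable def basePt : Vertex := ⟨half, MulAction.mem_orbit_self half⟩

/-- The Schreier graph `𝓗` of the action of `F` on the orbit of `1/2`. -/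
noncomputable def graphH : SimpleGraph Vertex := schreierGraph gens Vertex

/-- The real number represented by a vertex. -/
def Vertex.val (x : Vertex) : ℝ := ((x.1.1 : I) : ℝ)

/-- Black vertices: binary expansion `0.0…`. -/
def IsBlack (x : Vertex) : Prop := x.val < 1 / 2

/-- Grey vertices: binary expansion `0.10…`. -/
def IsGrey (x : Vertex) : Prop := 1 / 2 ≤ x.val ∧ x.val < 3 / 4

/-- White vertices: binary expansion `0.11…`. -/
def IsWhite (x : Vertex) : Prop := 3 / 4 ≤ x.val

/-- The vertices of the tree: the grey vertices other than `1/2`, and the white vertices adjacent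
to one of them. -/
def OnTree (x : Vertex) : Prop :=
  (IsGrey x ∧ x ≠ basePt) ∨ (IsWhite x ∧ ∃ y, IsGrey y ∧ y ≠ basePt ∧ graphH.Adj x y)

/-- The vertex `x` has type `i`. -/
def HasType (x : Vertex) : Fin 5 → Prop :=
  ![x = basePt,
    IsBlack x,
    IsGrey x ∧ x ≠ basePt,
    IsWhite x ∧ OnTree x,
    IsWhite x ∧ ¬ OnTree x]

/-- An element of `F` in the group ring. -/
noncomputable abbrev ofF (g : F) : MonoidAlgebra ℤ F := MonoidAlgebra.of ℤ F g

/-- The transition matrix with entries in the group ring. -/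
noncomputable def matrixAbold : Matrix (Fin 5) (Fin 5) (MonoidAlgebra ℤ F) :=
  !![0, ofF a, 0, ofF a⁻¹, 0;
     0, ofF a, 0, 0, 0;
     0, ofF a, ofF b, ofF a⁻¹, 0;
     0, 0, ofF b, 0, ofF a⁻¹ + ofF b⁻¹;
     0, 0, 0, 0, ofF a⁻¹ + ofF b⁻¹]

/-- The transition matrix for the numbers of geodesics. -/
noncomputable def matrixA : Matrix (Fin 5) (Fin 5) (PowerSeries ℝ) :=
  !![0, 1, 0, 1, 0;
     0, 1, 0, 0, 0;
     0, 1, 1, 1, 0;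
     0, 0, 1, 0, 2;
     0, 0, 0, 0, 2]

/-- The transition matrix for the numbers of end points of geodesics. -/
noncomputable def matrixB : Matrix (Fin 5) (Fin 5) (PowerSeries ℝ) :=
  !![0, 1, 0, 1, 0;
     0, 1, 0, 0, 0;
     0, 1, 1, 1, 0;
     0, 0, 1, 0, 1;
     0, 0, 0, 0, 1]

end Thompson

/-! ## The vertices of the Schreier graph -/

namespace Thompson

/-! Apart from loops and double edges, the Schreier graph is a tree rooted at `1/2`. The position of
a vertex in `(0, 1)` determines its type (`vertexType`), and the type determines what each of the
four letters does: it leads to a child of known type (`nextType`), fixes the vertex, or leads to its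
parent. Iterating `parent` always ends at `1/2`, so `depth` is well defined. It rises by at most one
per letter, hence it is the graph distance from `1/2` (`edist_basePt`) and bounds word lengths from
below (`depth_smul_le`).

Consequently the cone type of `x` consists of the elements spelled by words each of whose letters
goes to a child (`mem_coneType_iff`). By induction on the length, this set depends only on the type
of `x` (`ascents_eq`). The five rows of `nextType` allow five different sets of first letters, so
the five cone types differ.

The delicate point is that different ascending words give different elements of `F`
(`mul_letter_ne`). In the tree, two such words from one vertex can reach the same end point only by
differing in the choice of `a⁻¹` or `b⁻¹` along a double edge. These choices are told apart by
acting on a grey vertex, where `a⁻¹` ascends and `b⁻¹` descends.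

Splitting off the letter that acts first now gives the recurrences. Elements are counted with the
double edge counted twice, end points with it counted once; this is the only difference between
`matrixA` and `matrixB`. The linear systems are solved over power series, and the spheres have
Fibonacci cardinalities. -/

theorem dyadic_induction {P : Dyadics → Prop} (hhalf : P half)
    (hblack : ∀ t : Dyadics, 0 < (t.1 : ℝ) → (t.1 : ℝ) < 1 / 2 → P (a⁻¹ • t) → P t)
    (hgrey : ∀ t : Dyadics, 1 / 2 < (t.1 : ℝ) → (t.1 : ℝ) < 3 / 4 → P (b⁻¹ • t) → P t)
    (hwhite : ∀ t : Dyadics, 3 / 4 ≤ (t.1 : ℝ) → (t.1 : ℝ) < 1 → P (a • t) → P t)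
    (t : Dyadics) (h0 : 0 < (t.1 : ℝ)) (h1 : (t.1 : ℝ) < 1) : P t := by
  -- Induction on the exponent `n` of a denominator `2 ^ n`. Each move towards `1/2` lowers the
  -- exponent, possibly only after one or two intermediate moves.
  have key : ∀ n : ℕ, ∀ t : Dyadics, 0 < (t.1 : ℝ) → (t.1 : ℝ) < 1 →
      (∃ m : ℤ, (t.1 : ℝ) * 2 ^ n = m) → P t := by
    intro n
    induction n with
    | zero =>
      rintro t h0 h1 ⟨m, hm⟩
      rw [pow_zero, mul_one] at hm
      rw [hm] at h0 h1
      norm_cast at h0 h1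
      lia
    | succ n ih =>
      have grey : ∀ t : Dyadics, 1 / 2 ≤ (t.1 : ℝ) → (t.1 : ℝ) < 3 / 4 →
          (∃ m : ℤ, (t.1 : ℝ) * 2 ^ (n + 1) = m) → P t := by
        rintro t h0 h1 ⟨m, hm⟩
        rcases h0.eq_or_lt with h | h0
        · have : t = half := Subtype.ext (Subtype.ext h.symm)
          rwa [this]
        -- A dyadic number strictly between `1/2` and `3/4` has denominator at least `8`, so `n + 1
        -- ≥ 3`.
        obtain ⟨k, rfl⟩ : ∃ k, n = k + 2 := by
          rcases n with _ | _ | k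
          · exfalso
            norm_num at hm
            have e1 : (1 : ℝ) < m := by linarith
            have e2 : (m : ℝ) < 2 := by linarith
            norm_cast at e1 e2
            lia
          · exfalso
            norm_num at hm
            have e1 : (2 : ℝ) < m := by linarith
            have e2 : (m : ℝ) < 3 := by linarith
            norm_cast at e1 e2
            lia
          · exact ⟨k, rfl⟩
        refine hgrey t h0 h1 ?_
        have hv : ((b⁻¹ • t).1 : ℝ) = if (t.1 : ℝ) ≤ 1 / 2 then (t.1 : ℝ) else
          if (t.1 : ℝ) ≤ 5 / 8 then 2 * (t.1 : ℝ) - 1 / 2 else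
          if (t.1 : ℝ) ≤ 3 / 4 then (t.1 : ℝ) + 1 / 8 else ((t.1 : ℝ) + 1) / 2 := rfl
        rw [if_neg (by linarith)] at hv
        split_ifs at hv with h2 h3
        · refine ih _ (by linarith) (by linarith) ⟨m - 2 * 2 ^ k, ?_⟩
          rw [hv]
          push_cast
          rw [← hm]
          ring
        -- On `(5/8, 3/4)` the map `b⁻¹` adds `1/8` and saves nothing, but it lands in the white
        -- part, where `a` then doubles.
        · refine hwhite _ (by linarith) (by linarith) ?_
          have hw : ((a • b⁻¹ • t).1 : ℝ) = if ((b⁻¹ • t).1 : ℝ) ≤ 1 / 2 then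
            ((b⁻¹ • t).1 : ℝ) / 2 else if ((b⁻¹ • t).1 : ℝ) ≤ 3 / 4 then
            ((b⁻¹ • t).1 : ℝ) - 1 / 4 else 2 * ((b⁻¹ • t).1 : ℝ) - 1 := rfl
          rw [if_neg (by linarith), if_neg (by linarith)] at hw
          refine ih _ (by linarith) (by linarith) ⟨m - 3 * 2 ^ k, ?_⟩
          rw [hw, hv]
          push_cast
          rw [← hm]
          ring
        · linarith
      rintro t h0 h1 ⟨m, hm⟩
      rcases lt_or_ge (t.1 : ℝ) (1 / 2) with h2 | h2
      · refine hblack t h0 h2 ?_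
        have hv : ((a⁻¹ • t).1 : ℝ) = if (t.1 : ℝ) ≤ 1 / 4 then 2 * (t.1 : ℝ) else
          if (t.1 : ℝ) ≤ 1 / 2 then (t.1 : ℝ) + 1 / 4 else ((t.1 : ℝ) + 1) / 2 := rfl
        split_ifs at hv with h3
        · refine ih _ (by linarith) (by linarith) ⟨m, ?_⟩
          rw [hv, ← hm]
          ring
        -- Adding `1/4` keeps the exponent `n + 1`, so the grey case, proved at that same exponent,
        -- is needed here.
        · refine grey _ (by linarith) (by linarith) ?_
          rcases n with _ | k
          · exfalso
            norm_num at hm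
            have e1 : (0 : ℝ) < m := by linarith
            have e2 : (m : ℝ) < 1 := by linarith
            norm_cast at e1 e2
            lia
          · refine ⟨m + 2 ^ k, ?_⟩
            rw [hv]
            push_cast
            rw [← hm]
            ring
        · linarith
      rcases lt_or_ge (t.1 : ℝ) (3 / 4) with h3 | h3
      · exact grey t h2 h3 ⟨m, hm⟩
      · rcases h3.eq_or_lt with h4 | h4
        · refine hwhite t h3 h1 (grey _ ?_ ?_ ?_)
          all_goals
            have hv : ((a • t).1 : ℝ) = if (t.1 : ℝ) ≤ 1 / 2 then (t.1 : ℝ) / 2 else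
              if (t.1 : ℝ) ≤ 3 / 4 then (t.1 : ℝ) - 1 / 4 else 2 * (t.1 : ℝ) - 1 := rfl
            rw [if_neg (by linarith), if_pos h4.ge] at hv
            rw [hv]
          · linarith
          · linarith
          · refine ⟨2 ^ n, ?_⟩
            rw [← h4]
            push_cast
            ring
        · refine hwhite t h3 h1 ?_
          have hv : ((a • t).1 : ℝ) = if (t.1 : ℝ) ≤ 1 / 2 then (t.1 : ℝ) / 2 else
            if (t.1 : ℝ) ≤ 3 / 4 then (t.1 : ℝ) - 1 / 4 else 2 * (t.1 : ℝ) - 1 := rfl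
          rw [if_neg (by linarith), if_neg (by linarith)] at hv
          refine ih _ (by linarith) (by linarith) ⟨m - 2 ^ n, ?_⟩
          rw [hv]
          push_cast
          rw [← hm]
          ring
  obtain ⟨m, n, hmn⟩ := t.2
  exact key n t h0 h1 ⟨m, by rw [hmn]; field_simp⟩

theorem pos_and_lt_one_of_mem_orbit {t : Dyadics} (h : t ∈ MulAction.orbit F half) :
    0 < (t.1 : ℝ) ∧ (t.1 : ℝ) < 1 := by
  obtain ⟨f, rfl⟩ := h
  have hm := IsThompson.strictMono f.2
  have h0 := hm (show (0 : unitInterval) < half.1 from by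
    rw [← Subtype.coe_lt_coe]; norm_num [half])
  have h1 := hm (show half.1 < (1 : unitInterval) from by
    rw [← Subtype.coe_lt_coe]; norm_num [half])
  exact ⟨lt_of_le_of_lt (f.1 0).2.1 (Subtype.coe_lt_coe.2 h0),
    lt_of_lt_of_le (Subtype.coe_lt_coe.2 h1) (f.1 1).2.2⟩

theorem mem_orbit_of_smul_mem {t : Dyadics} (g : F) (h : g • t ∈ MulAction.orbit F half) :
    t ∈ MulAction.orbit F half := by
  have := MulAction.mem_orbit_of_mem_orbit g⁻¹ h
  rwa [inv_smul_smul] at this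

theorem mem_orbit_half_iff (t : Dyadics) :
    t ∈ MulAction.orbit F half ↔ 0 < (t.1 : ℝ) ∧ (t.1 : ℝ) < 1 :=
  ⟨pos_and_lt_one_of_mem_orbit, fun h => dyadic_induction (MulAction.mem_orbit_self _)
    (fun _ _ _ => mem_orbit_of_smul_mem _) (fun _ _ _ => mem_orbit_of_smul_mem _)
    (fun _ _ _ => mem_orbit_of_smul_mem _) t h.1 h.2⟩

theorem Vertex.val_pos (x : Vertex) : 0 < x.val := (pos_and_lt_one_of_mem_orbit x.2).1

theorem Vertex.val_lt_one (x : Vertex) : x.val < 1 := (pos_and_lt_one_of_mem_orbit x.2).2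

theorem Vertex.ext_val {x y : Vertex} (h : x.val = y.val) : x = y :=
  Subtype.ext (Subtype.ext (Subtype.ext h))

theorem val_basePt : basePt.val = 1 / 2 := rfl

theorem Vertex.eq_basePt_iff {x : Vertex} : x = basePt ↔ x.val = 1 / 2 :=
  ⟨fun h => by rw [h, val_basePt], fun h => Vertex.ext_val (by rw [h, val_basePt])⟩

theorem val_a_smul (x : Vertex) : (a • x).val = if x.val ≤ 1 / 2 then x.val / 2 else
    if x.val ≤ 3 / 4 then x.val - 1 / 4 else 2 * x.val - 1 := rfl

theorem val_a_inv_smul (x : Vertex) : (a⁻¹ • x).val = if x.val ≤ 1 / 4 then 2 * x.val else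
    if x.val ≤ 1 / 2 then x.val + 1 / 4 else (x.val + 1) / 2 := rfl

theorem val_b_smul (x : Vertex) : (b • x).val = if x.val ≤ 1 / 2 then x.val else
    if x.val ≤ 3 / 4 then x.val / 2 + 1 / 4 else
      if x.val ≤ 7 / 8 then x.val - 1 / 8 else 2 * x.val - 1 := rfl

theorem val_b_inv_smul (x : Vertex) : (b⁻¹ • x).val = if x.val ≤ 1 / 2 then x.val else
    if x.val ≤ 5 / 8 then 2 * x.val - 1 / 2 else
      if x.val ≤ 3 / 4 then x.val + 1 / 8 else (x.val + 1) / 2 := rfl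

/-! ### Local structure of the graph: types, children and parents -/

/-- The type of a vertex, read off from its position in `(0, 1)`. -/
noncomputable def vertexType (x : Vertex) : Fin 5 :=
  if x.val < 1 / 2 then 1 else if x.val ≤ 1 / 2 then 0 else if x.val < 3 / 4 then 2 else
    if x.val < 7 / 8 then 3 else 4

theorem vertexType_eq_zero {x : Vertex} : vertexType x = 0 ↔ x.val = 1 / 2 := by
  unfold vertexType
  split_ifs <;> simp <;> grind

theorem vertexType_eq_one {x : Vertex} : vertexType x = 1 ↔ x.val < 1 / 2 := by
  unfold vertexType
  split_ifs <;> simp <;> grind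

theorem vertexType_eq_two {x : Vertex} : vertexType x = 2 ↔ 1 / 2 < x.val ∧ x.val < 3 / 4 := by
  unfold vertexType
  split_ifs <;> simp <;> grind

theorem vertexType_eq_three {x : Vertex} : vertexType x = 3 ↔ 3 / 4 ≤ x.val ∧ x.val < 7 / 8 := by
  unfold vertexType
  split_ifs <;> simp <;> grind

theorem vertexType_eq_four {x : Vertex} : vertexType x = 4 ↔ 7 / 8 ≤ x.val := by
  unfold vertexType
  split_ifs <;> simp <;> grind

/-- The generators and their inverses. -/
noncomputable def letter : Fin 4 → F := ![a, b, a⁻¹, b⁻¹]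

/-- The type of the vertex reached from a vertex of the given type by a letter that leads away
from `1/2`. -/
def nextType : Fin 5 → Fin 4 → Option (Fin 5) :=
  ![![some 1, none, some 3, none],
    ![some 1, none, none, none],
    ![some 1, some 2, some 3, none],
    ![none, some 2, some 4, some 4],
    ![none, none, some 4, some 4]]

/-- The neighbour of a vertex on the way to `1/2`. -/
noncomputable def parent (x : Vertex) : Vertex := (![1, a⁻¹, b⁻¹, a, a] (vertexType x) : F) • x

theorem parent_basePt : parent basePt = basePt := by
  have : vertexType basePt = 0 := vertexType_eq_zero.2 val_basePt
  simp [parent, this]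

/-- The source of the double edges: below a white vertex, `a⁻¹` and `b⁻¹` lead to the same child. -/
theorem b_inv_smul_eq_a_inv_smul {x : Vertex} (h : 3 / 4 ≤ x.val) : b⁻¹ • x = a⁻¹ • x := by
  apply Vertex.ext_val
  rw [val_a_inv_smul, val_b_inv_smul]
  grind

theorem b_smul_eq_a_smul {x : Vertex} (h : 7 / 8 ≤ x.val) : b • x = a • x := by
  apply Vertex.ext_val
  rw [val_a_smul, val_b_smul]
  grind

theorem b_smul_eq_self {x : Vertex} (h : x.val ≤ 1 / 2) : b • x = x := by
  apply Vertex.ext_val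
  rw [val_b_smul, if_pos h]

theorem b_inv_smul_eq_self {x : Vertex} (h : x.val ≤ 1 / 2) : b⁻¹ • x = x := by
  apply Vertex.ext_val
  rw [val_b_inv_smul, if_pos h]

theorem vertexType_letter_smul {x : Vertex} {l : Fin 4} {j : Fin 5}
    (h : nextType (vertexType x) l = some j) : vertexType (letter l • x) = j := by
  have h0 := x.val_pos
  have h1 := x.val_lt_one
  have ha := val_a_smul x
  have ha' := val_a_inv_smul x
  have hb := val_b_smul x
  have hb' := val_b_inv_smul x
  generalize ht : vertexType x = i at h
  fin_cases i <;> fin_cases l <;> simp [nextType] at h <;> subst h <;>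
    simp [letter, vertexType_eq_zero, vertexType_eq_one, vertexType_eq_two, vertexType_eq_three,
      vertexType_eq_four] at ht ⊢ <;> grind

/-- This makes the graph a tree: each ascending letter is undone by `parent`. The child of a white
vertex along `b⁻¹` is no exception, since there `b⁻¹` acts as `a⁻¹` and `a` leads back. -/
theorem parent_letter_smul {x : Vertex} {l : Fin 4} {j : Fin 5}
    (h : nextType (vertexType x) l = some j) : parent (letter l • x) = x := by
  have hj := vertexType_letter_smul h
  rw [parent, hj]
  have e : vertexType x = 3 ∨ vertexType x = 4 → b⁻¹ • x = a⁻¹ • x := fun h =>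
    b_inv_smul_eq_a_inv_smul <| h.elim (fun h => (vertexType_eq_three.1 h).1)
      fun h => by linarith [vertexType_eq_four.1 h]
  generalize ht : vertexType x = i at h e
  fin_cases i <;> fin_cases l <;> simp [nextType] at h <;> subst h <;>
    simp [letter] <;> simp at e <;> simp [e]

theorem letter_smul_of_nextType_eq_none {x : Vertex} {l : Fin 4}
    (h : nextType (vertexType x) l = none) : letter l • x = x ∨ letter l • x = parent x := by
  have e : vertexType x = 0 ∨ vertexType x = 1 → b • x = x ∧ b⁻¹ • x = x := fun h =>
    have : x.val ≤ 1 / 2 := h.elim (fun h => (vertexType_eq_zero.1 h).le)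
      fun h => (vertexType_eq_one.1 h).le
    ⟨b_smul_eq_self this, b_inv_smul_eq_self this⟩
  have e' : vertexType x = 4 → b • x = a • x := fun h =>
    b_smul_eq_a_smul (vertexType_eq_four.1 h)
  rw [parent]
  generalize ht : vertexType x = i at h e e'
  fin_cases i <;> fin_cases l <;> simp [nextType] at h <;> simp [letter] <;> simp at e e' <;>
    simp [e, e']

/-- Children along different letters have different types in every row of `nextType`, except for the
two entries of type 4 reached by `a⁻¹` and `b⁻¹`. -/
theorem eq_or_of_letter_smul_eq {x : Vertex} {l l' : Fin 4} {j j' : Fin 5}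
    (h : nextType (vertexType x) l = some j) (h' : nextType (vertexType x) l' = some j')
    (hll : l ≠ l') (he : letter l • x = letter l' • x) :
    (l = 2 ∧ l' = 3 ∨ l = 3 ∧ l' = 2) ∧ j = 4 ∧ j' = 4 := by
  have : j = j' := by rw [← vertexType_letter_smul h, ← vertexType_letter_smul h', he]
  subst this
  have key : ∀ i j l l', nextType i l = some j → nextType i l' = some j → l ≠ l' →
      (l = 2 ∧ l' = 3 ∨ l = 3 ∧ l' = 2) ∧ j = 4 ∧ j = 4 := by decide
  exact key _ _ _ _ h h' hll

/-! ### Depth in the tree -/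

theorem exists_iterate_parent (x : Vertex) : ∃ k, parent^[k] x = basePt := by
  -- The three moves of `dyadic_induction` are exactly those of `parent`. The predicate quantifies
  -- over orbit membership because the induction runs over all dyadics.
  have h := dyadic_induction (P := fun t => ∀ h : t ∈ MulAction.orbit F half,
    ∃ k, parent^[k] ⟨t, h⟩ = basePt) (fun h => ⟨0, rfl⟩) ?_ ?_ ?_ x.1 x.val_pos x.val_lt_one
  · exact h x.2
  · intro t h0 h1 ih h
    obtain ⟨k, hk⟩ := ih (MulAction.mem_orbit_of_mem_orbit _ h)
    refine ⟨k + 1, ?_⟩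
    rw [Function.iterate_succ_apply, parent, vertexType_eq_one.2 (by exact h1)]
    exact hk
  · intro t h0 h1 ih h
    obtain ⟨k, hk⟩ := ih (MulAction.mem_orbit_of_mem_orbit _ h)
    refine ⟨k + 1, ?_⟩
    rw [Function.iterate_succ_apply, parent, vertexType_eq_two.2 (by exact ⟨h0, h1⟩)]
    exact hk
  · intro t h0 h1 ih h
    obtain ⟨k, hk⟩ := ih (MulAction.mem_orbit_of_mem_orbit _ h)
    refine ⟨k + 1, ?_⟩
    rw [Function.iterate_succ_apply, parent]
    rcases lt_or_ge (t.1 : ℝ) (7 / 8) with h2 | h2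
    · rw [vertexType_eq_three.2 (by exact ⟨h0, h2⟩)]
      exact hk
    · rw [vertexType_eq_four.2 (by exact h2)]
      exact hk

open Classical in
/-- The distance of a vertex to `1/2`, as the number of steps of `parent`. -/
noncomputable def depth (x : Vertex) : ℕ := Nat.find (exists_iterate_parent x)

theorem depth_eq_zero_iff {x : Vertex} : depth x = 0 ↔ x = basePt := by
  simp [depth]

theorem depth_parent {x : Vertex} (h : x ≠ basePt) : depth x = depth (parent x) + 1 := by
  classical
  unfold depth
  exact Nat.find_comp_succ (exists_iterate_parent x) (exists_iterate_parent (parent x)) h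

theorem depth_parent_le (x : Vertex) : depth (parent x) ≤ depth x := by
  by_cases h : x = basePt
  · rw [h, parent_basePt]
  · rw [depth_parent h]; lia

theorem depth_letter_smul {x : Vertex} {l : Fin 4} {j : Fin 5}
    (h : nextType (vertexType x) l = some j) : depth (letter l • x) = depth x + 1 := by
  rw [depth_parent, parent_letter_smul h]
  intro he
  have hj := vertexType_letter_smul h
  rw [he, vertexType_eq_zero.2 val_basePt] at hj
  subst hj
  have key : ∀ i l, nextType i l ≠ some 0 := by decide
  exact key _ _ h

theorem depth_letter_smul_le_of_none {x : Vertex} {l : Fin 4}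
    (h : nextType (vertexType x) l = none) : depth (letter l • x) ≤ depth x := by
  rcases letter_smul_of_nextType_eq_none h with h | h <;> rw [h]
  exact depth_parent_le x

theorem depth_letter_smul_le (x : Vertex) (l : Fin 4) : depth (letter l • x) ≤ depth x + 1 := by
  rcases h : nextType (vertexType x) l with _ | j
  · exact (depth_letter_smul_le_of_none h).trans (Nat.le_succ _)
  · exact (depth_letter_smul h).le

theorem depth_letter_smul_iff {x : Vertex} {l : Fin 4} :
    depth (letter l • x) = depth x + 1 ↔ ∃ j, nextType (vertexType x) l = some j := by
  refine ⟨fun h => ?_, fun ⟨j, h⟩ => depth_letter_smul h⟩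
  rcases h' : nextType (vertexType x) l with _ | j
  · have := depth_letter_smul_le_of_none h'
    lia
  · exact ⟨j, rfl⟩

end Thompson

/-! ## Geodesics and cone types -/

namespace Thompson

theorem hasType_iff {x : Vertex} {i : Fin 5} : HasType x i ↔ vertexType x = i := by
  have h1 := x.val_lt_one
  -- The generator `b` maps `[3/4, 7/8)` into the grey vertices other than `1/2`. From `7/8` on,
  -- both generators lead to white vertices, and neither sends a grey vertex to a white one.
  have htree : 3 / 4 ≤ x.val → (OnTree x ↔ x.val < 7 / 8) := by
    intro hx
    constructor
    · rintro (⟨⟨-, h⟩, -⟩ | ⟨-, y, hy, -, hadj⟩)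
      · linarith
      · by_contra! hx'
        obtain ⟨-, hadj | hadj⟩ := hadj
        · obtain ⟨s, rfl | rfl, hs⟩ := hadj
          · have := val_a_smul x
            rw [hs] at this
            grind [IsGrey]
          · have := val_b_smul x
            rw [hs] at this
            grind [IsGrey]
        · obtain ⟨s, rfl | rfl, hs⟩ := hadj
          · have := val_a_smul y
            rw [hs] at this
            grind [IsGrey]
          · have := val_b_smul y
            rw [hs] at this
            grind [IsGrey]
    · intro hx'
      have hb : (b • x).val = x.val - 1 / 8 := by
        rw [val_b_smul]
        grind
      refine Or.inr ⟨hx, b • x, ⟨by linarith, by linarith⟩, ?_, ?_, Or.inl ⟨b, Or.inr rfl, rfl⟩⟩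
      · rw [Ne, Vertex.eq_basePt_iff]
        linarith
      · intro he
        rw [← he] at hb
        linarith
  fin_cases i
  · exact Vertex.eq_basePt_iff.trans vertexType_eq_zero.symm
  · exact vertexType_eq_one.symm
  · refine Iff.trans ?_ vertexType_eq_two.symm
    change (1 / 2 ≤ x.val ∧ x.val < 3 / 4) ∧ x ≠ basePt ↔ _
    rw [Ne, Vertex.eq_basePt_iff]
    grind
  · refine Iff.trans ?_ vertexType_eq_three.symm
    exact and_congr_right htree
  · refine Iff.trans ?_ vertexType_eq_four.symm
    change 3 / 4 ≤ x.val ∧ ¬ OnTree x ↔ _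
    rw [and_congr_right fun h => not_congr (htree h)]
    grind

theorem exists_vertexType (i : Fin 5) : ∃ x, vertexType x = i := by
  have h0 : vertexType basePt = 0 := vertexType_eq_zero.2 val_basePt
  have h3 : vertexType (letter 2 • basePt) = 3 := vertexType_letter_smul (by rw [h0]; rfl)
  fin_cases i
  · exact ⟨_, h0⟩
  · exact ⟨_, vertexType_letter_smul (x := basePt) (l := 0) (by rw [h0]; rfl)⟩
  · exact ⟨_, vertexType_letter_smul (x := letter 2 • basePt) (l := 1) (by rw [h3]; rfl)⟩
  · exact ⟨_, h3⟩
  · exact ⟨_, vertexType_letter_smul (x := letter 2 • basePt) (l := 2) (by rw [h3]; rfl)⟩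

theorem letter_ne_one (l : Fin 4) : letter l ≠ 1 := by
  have key : ∀ l, ∃ i j, nextType i l = some j := by decide
  obtain ⟨i, j, h⟩ := key l
  obtain ⟨x, rfl⟩ := exists_vertexType i
  intro he
  have := depth_letter_smul h
  rw [he, one_smul] at this
  lia

theorem mem_gens_or_inv_mem_gens {s : F} : s ∈ gens ∨ s⁻¹ ∈ gens ↔ ∃ l, s = letter l := by
  simp [gens, letter, Fin.exists_fin_succ, inv_eq_iff_eq_inv, or_assoc]

/-! ### Words and ascents -/

theorem isWordFor_nil {g : F} : IsWordFor gens [] g ↔ g = 1 := by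
  simp [IsWordFor, eq_comm]

theorem isWordFor_append {u v : List F} {g h : F} (hu : IsWordFor gens u g)
    (hv : IsWordFor gens v h) : IsWordFor gens (u ++ v) (g * h) := by
  refine ⟨fun s hs => (List.mem_append.1 hs).elim (hu.1 s) (hv.1 s), ?_⟩
  rw [List.prod_append, hu.2, hv.2]

theorem isWordFor_letter (l : Fin 4) : IsWordFor gens [letter l] (letter l) :=
  ⟨by simpa using mem_gens_or_inv_mem_gens.2 ⟨l, rfl⟩, by simp⟩

theorem exists_append_of_isWordFor {u : List F} {g : F} {n : ℕ} (hu : IsWordFor gens u g)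
    (hn : u.length = n + 1) : ∃ v h l, IsWordFor gens v h ∧ v.length = n ∧
      u = v ++ [letter l] ∧ g = h * letter l := by
  obtain ⟨v, s, rfl⟩ := (List.eq_nil_or_concat' u).resolve_left
    (List.ne_nil_of_length_eq_add_one hn)
  obtain ⟨l, rfl⟩ := mem_gens_or_inv_mem_gens.1 (hu.1 s (by simp))
  refine ⟨v, v.prod, l, ⟨fun s hs => hu.1 s (by simp [hs]), rfl⟩, by simpa using hn, rfl, ?_⟩
  rw [← hu.2]
  simp

theorem depth_smul_le {u : List F} {g : F} (hu : IsWordFor gens u g) (x : Vertex) :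
    depth (g • x) ≤ depth x + u.length := by
  induction hn : u.length generalizing u g x with
  | zero =>
    rw [List.length_eq_zero_iff] at hn
    subst hn
    rw [isWordFor_nil.1 hu, one_smul]
    lia
  | succ n ih =>
    obtain ⟨v, h, l, hv, hvn, rfl, rfl⟩ := exists_append_of_isWordFor hu hn
    have := ih hv (letter l • x) hvn
    have := depth_letter_smul_le x l
    rw [mul_smul]
    lia

/-- A finite value excludes the empty infimum `⊤`, and an infimum in `ℕ∞` over a nonempty family is
attained. -/
theorem exists_isWordFor_of_wordLength_eq {g : F} {n : ℕ} (h : wordLength gens g = n) :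
    ∃ u, IsWordFor gens u g ∧ u.length = n := by
  have hne : Nonempty {u : List F // IsWordFor gens u g} := by
    by_contra hne
    rw [not_nonempty_iff, isEmpty_subtype] at hne
    simp [wordLength, hne] at h
  rw [wordLength, ← iInf_subtype (p := fun u => IsWordFor gens u g)
    (f := fun u => (u.1.length : ℕ∞))] at h
  obtain ⟨⟨u, hu⟩, hu'⟩ := ENat.exists_eq_iInf fun u : {u // IsWordFor gens u g} =>
    (u.1.length : ℕ∞)
  refine ⟨u, hu, ?_⟩
  rw [h] at hu'
  exact_mod_cast hu'

theorem wordLength_le {u : List F} {g : F} (hu : IsWordFor gens u g) :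
    wordLength gens g ≤ u.length := iInf₂_le u hu

/-- The elements given by a word of length `n` each letter of which, read from the vertex `x`,
leads away from `1/2`. -/
def ascents (x : Vertex) (n : ℕ) : Set F :=
  {g | ∃ u, IsWordFor gens u g ∧ u.length = n ∧ depth (g • x) = depth x + n}

/-- Any word for `g` must raise the depth of `x` by `n`, at most one per letter, so none is shorter
than `n`. -/
theorem wordLength_eq_of_mem_ascents {x : Vertex} {n : ℕ} {g : F} (h : g ∈ ascents x n) :
    wordLength gens g = n := by
  obtain ⟨u, hu, rfl, hd⟩ := h
  refine le_antisymm (wordLength_le hu) (le_iInf₂ fun v hv => ?_)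
  have := depth_smul_le hv x
  exact_mod_cast (by lia : u.length ≤ v.length)

theorem mem_ascents_iff {x : Vertex} {n : ℕ} {g : F} :
    g ∈ ascents x n ↔ wordLength gens g = n ∧ depth (g • x) = depth x + n := by
  refine ⟨fun h => ⟨wordLength_eq_of_mem_ascents h, h.choose_spec.2.2⟩, fun ⟨h, hd⟩ => ?_⟩
  obtain ⟨u, hu, hn⟩ := exists_isWordFor_of_wordLength_eq h
  exact ⟨u, hu, hn, hd⟩

theorem ascents_zero (x : Vertex) : ascents x 0 = {1} := by
  ext g
  constructor
  · rintro ⟨u, hu, hn, -⟩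
    rw [List.length_eq_zero_iff] at hn
    subst hn
    exact isWordFor_nil.1 hu
  · rintro rfl
    exact ⟨[], isWordFor_nil.2 rfl, rfl, by simp⟩

/-- A gain of `n + 1` in `n + 1` letters forces every letter to ascend. The action is on the left,
so the first step is the rightmost letter. -/
theorem mem_ascents_succ {x : Vertex} {n : ℕ} {g : F} : g ∈ ascents x (n + 1) ↔
    ∃ l j, nextType (vertexType x) l = some j ∧ ∃ h ∈ ascents (letter l • x) n,
      h * letter l = g := by
  constructor
  · rintro ⟨u, hu, hn, hd⟩
    obtain ⟨v, h, l, hv, hvn, rfl, rfl⟩ := exists_append_of_isWordFor hu hn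
    have h1 := depth_smul_le hv (letter l • x)
    have h2 := depth_letter_smul_le x l
    rw [mul_smul] at hd
    obtain ⟨j, hj⟩ := depth_letter_smul_iff.1 (by lia : depth (letter l • x) = depth x + 1)
    exact ⟨l, j, hj, h, ⟨v, hv, hvn, by lia⟩, rfl⟩
  · rintro ⟨l, j, hj, h, ⟨v, hv, hvn, hd⟩, rfl⟩
    refine ⟨v ++ [letter l], isWordFor_append hv (isWordFor_letter l), by simp [hvn], ?_⟩
    rw [mul_smul, hd, depth_letter_smul hj]
    ring

theorem ascents_add {x : Vertex} {m n : ℕ} {g w : F} (hw : w ∈ ascents x m)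
    (hg : g ∈ ascents (w • x) n) : g * w ∈ ascents x (n + m) := by
  obtain ⟨u, hu, hn, hd⟩ := hg
  obtain ⟨v, hv, hm, hd'⟩ := hw
  refine ⟨u ++ v, isWordFor_append hu hv, by simp [hn, hm], ?_⟩
  rw [mul_smul, hd, hd']
  ring

theorem letter_mem_ascents_one {x : Vertex} {l : Fin 4} {j : Fin 5}
    (h : nextType (vertexType x) l = some j) : letter l ∈ ascents x 1 :=
  mem_ascents_succ.2 ⟨l, j, h, 1, by simp [ascents_zero], one_mul _⟩

theorem exists_parent_letter {x : Vertex} (h : x ≠ basePt) :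
    ∃ l j, nextType (vertexType (parent x)) l = some j ∧ letter l • parent x = x := by
  have key : ∀ s : F, (∃ l, s = letter l) → parent x = s • x → ∃ l j,
      nextType (vertexType (parent x)) l = some j ∧ letter l • parent x = x := by
    intro s hs hp
    obtain ⟨l, hl⟩ := mem_gens_or_inv_mem_gens.1
      (by rw [inv_inv]; exact (mem_gens_or_inv_mem_gens.2 hs).symm : s⁻¹ ∈ gens ∨ s⁻¹⁻¹ ∈ gens)
    have e : letter l • parent x = x := by rw [hp, ← hl, inv_smul_smul]
    obtain ⟨j, hj⟩ := depth_letter_smul_iff.1 (by rw [e]; exact depth_parent h :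
      depth (letter l • parent x) = depth (parent x) + 1)
    exact ⟨l, j, hj, e⟩
  have hp : parent x = (![1, a⁻¹, b⁻¹, a, a] (vertexType x) : F) • x := rfl
  generalize hi : vertexType x = i at hp
  fin_cases i
  · exact absurd (Vertex.eq_basePt_iff.2 (vertexType_eq_zero.1 hi)) h
  · exact key a⁻¹ ⟨2, rfl⟩ hp
  · exact key b⁻¹ ⟨3, rfl⟩ hp
  · exact key a ⟨0, rfl⟩ hp
  · exact key a ⟨0, rfl⟩ hp

theorem exists_mem_ascents_smul_eq (x : Vertex) :
    ∃ w ∈ ascents basePt (depth x), w • basePt = x := by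
  induction hn : depth x generalizing x with
  | zero => exact ⟨1, by simp [ascents_zero], by rw [depth_eq_zero_iff.1 hn, one_smul]⟩
  | succ n ih =>
    have hx : x ≠ basePt := fun h => by rw [depth_eq_zero_iff.2 h] at hn; lia
    obtain ⟨w, hw, hwx⟩ := ih (parent x) (by have := depth_parent hx; lia)
    obtain ⟨l, j, hj, e⟩ := exists_parent_letter hx
    refine ⟨letter l * w, ?_, by rw [mul_smul, hwx, e]⟩
    rw [add_comm]
    exact ascents_add hw (by rw [hwx]; exact letter_mem_ascents_one hj)

theorem adj_letter_smul {x : Vertex} {l : Fin 4} (h : letter l • x ≠ x) :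
    graphH.Adj x (letter l • x) := by
  refine ⟨h.symm, ?_⟩
  rcases mem_gens_or_inv_mem_gens.2 ⟨l, rfl⟩ with hl | hl
  · exact Or.inl ⟨_, hl, rfl⟩
  · exact Or.inr ⟨_, hl, inv_smul_smul _ _⟩

theorem exists_letter_of_adj {x y : Vertex} (h : graphH.Adj x y) : ∃ l, letter l • x = y := by
  obtain ⟨-, ⟨s, hs, e⟩ | ⟨s, hs, e⟩⟩ := h
  · obtain ⟨l, rfl⟩ := mem_gens_or_inv_mem_gens.1 (Or.inl hs)
    exact ⟨l, e⟩
  · obtain ⟨l, hl⟩ := mem_gens_or_inv_mem_gens.1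
      (Or.inr (by rwa [inv_inv]) : s⁻¹ ∈ gens ∨ s⁻¹⁻¹ ∈ gens)
    exact ⟨l, by rw [← hl, ← e, inv_smul_smul]⟩

/-- The chain of parents is a path of length `depth x`, and along any walk the depth grows by at
most one per edge. -/
theorem edist_basePt (x : Vertex) : graphH.edist basePt x = depth x := by
  apply le_antisymm
  · induction hn : depth x generalizing x with
    | zero => rw [depth_eq_zero_iff.1 hn]; simp
    | succ n ih =>
      have hx : x ≠ basePt := fun h => by rw [depth_eq_zero_iff.2 h] at hn; lia
      obtain ⟨l, j, hj, e⟩ := exists_parent_letter hx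
      have hadj : graphH.Adj (parent x) x := by
        have := adj_letter_smul (x := parent x) (l := l) fun he => by
          have := depth_letter_smul hj
          rw [he] at this
          lia
        rwa [e] at this
      calc graphH.edist basePt x
          ≤ graphH.edist basePt (parent x) + graphH.edist (parent x) x :=
            SimpleGraph.edist_triangle
        _ ≤ n + 1 := add_le_add (ih _ (by have := depth_parent hx; lia))
            (SimpleGraph.edist_eq_one_iff_adj.2 hadj).le
        _ = _ := by push_cast; rfl
  · have key : ∀ y z (w : graphH.Walk y z), depth z ≤ depth y + w.length := by
      intro y z w
      induction w with
      | nil => simp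
      | @cons u v z h w ih =>
        obtain ⟨l, rfl⟩ := exists_letter_of_adj h
        have := depth_letter_smul_le u l
        rw [SimpleGraph.Walk.length_cons]
        lia
    refine le_iInf fun w => ?_
    have := key _ _ w
    rw [depth_eq_zero_iff.2 rfl, zero_add] at this
    exact_mod_cast this

theorem isGeodesicOfLength_iff {g : F} {n : ℕ} :
    IsGeodesicOfLength gens basePt g n ↔ g ∈ ascents basePt n := by
  rw [mem_ascents_iff, depth_eq_zero_iff.2 rfl, zero_add]
  refine and_congr_right fun _ => ?_
  change graphH.edist basePt (g • basePt) = n ↔ _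
  rw [edist_basePt]
  norm_cast

/-- Some geodesic reaches `x`, so the universal condition in `coneType` is not vacuous; conversely,
ascents compose. -/
theorem mem_coneType_iff {x : Vertex} {g : F} :
    g ∈ coneType gens basePt x ↔ ∃ n, g ∈ ascents x n := by
  constructor
  · intro h
    obtain ⟨w, hw, rfl⟩ := exists_mem_ascents_smul_eq x
    obtain ⟨n, hn, hg⟩ := h w _ (isGeodesicOfLength_iff.2 hw) rfl
    rw [isGeodesicOfLength_iff, mem_ascents_iff, mul_smul, depth_eq_zero_iff.2 rfl] at hg
    exact ⟨n, mem_ascents_iff.2 ⟨hn, by lia⟩⟩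
  · rintro ⟨n, hn⟩ w m hw rfl
    rw [isGeodesicOfLength_iff] at hw
    refine ⟨n, wordLength_eq_of_mem_ascents hn, ?_⟩
    exact_mod_cast isGeodesicOfLength_iff.2 (ascents_add hw hn)

theorem coneLevel_eq (x : Vertex) (n : ℕ) : coneLevel gens basePt x n = ascents x n := by
  ext g
  refine ⟨fun ⟨h, hn⟩ => ?_, fun h => ⟨mem_coneType_iff.2 ⟨n, h⟩, wordLength_eq_of_mem_ascents h⟩⟩
  obtain ⟨m, hm⟩ := mem_coneType_iff.1 h
  have := wordLength_eq_of_mem_ascents hm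
  rw [hn] at this
  rwa [(by exact_mod_cast this : n = m)]

theorem ascents_subset {x y : Vertex} (n : ℕ)
    (h : vertexType x = vertexType y ∨ vertexType x = 4 ∧ vertexType y = 3) :
    ascents x n ⊆ ascents y n := by
  induction n generalizing x y with
  | zero => rw [ascents_zero, ascents_zero]
  | succ n ih =>
    intro g hg
    obtain ⟨l, j, hj, g, hg', rfl⟩ := mem_ascents_succ.1 hg
    have hj' : nextType (vertexType y) l = some j := by
      rcases h with h | ⟨h, h'⟩
      · rw [← h, hj]
      · rw [h] at hj
        rw [h']
        -- Row 4 of `nextType` is row 3 without the entry for `b`, so ascents from type 4 also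
        -- ascend from type 3. `mul_letter_ne` needs this inclusion.
        have key : ∀ l j, nextType 4 l = some j → nextType 3 l = some j := by decide
        exact key l j hj
    exact mem_ascents_succ.2 ⟨l, j, hj', g, ih (Or.inl
      (by rw [vertexType_letter_smul hj, vertexType_letter_smul hj'])) hg', rfl⟩

theorem ascents_eq {x y : Vertex} (h : vertexType x = vertexType y) (n : ℕ) :
    ascents x n = ascents y n :=
  (ascents_subset n (Or.inl h)).antisymm (ascents_subset n (Or.inl h.symm))

theorem coneType_eq_iff {x y : Vertex} :
    coneType gens basePt x = coneType gens basePt y ↔ vertexType x = vertexType y := by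
  constructor
  · intro h
    have key : ∀ (x : Vertex) l, letter l ∈ coneType gens basePt x ↔
        (nextType (vertexType x) l).isSome := by
      intro x l
      rw [Option.isSome_iff_exists, mem_coneType_iff]
      refine ⟨?_, fun ⟨j, hj⟩ => ⟨1, letter_mem_ascents_one hj⟩⟩
      rintro ⟨n, hn⟩
      have h1 := wordLength_le (isWordFor_letter l)
      rw [wordLength_eq_of_mem_ascents hn] at h1
      have h1 : n ≤ 1 := by exact_mod_cast h1
      rcases n with _ | n
      · rw [ascents_zero] at hn
        exact absurd hn (letter_ne_one l)
      · obtain rfl : n = 0 := by lia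
        exact depth_letter_smul_iff.1 (mem_ascents_iff.1 hn).2
    have h' : ∀ l, (nextType (vertexType x) l).isSome ↔ (nextType (vertexType y) l).isSome :=
      fun l => by rw [← key, ← key, h]
    revert h'
    generalize vertexType x = i
    generalize vertexType y = j
    clear * -
    -- The five rows of `nextType` have pairwise different sets of ascending letters.
    revert i j
    decide
  · intro h
    ext g
    simp_rw [mem_coneType_iff, ascents_eq h]

theorem iterate_parent_smul {x : Vertex} {n : ℕ} {g : F} (h : g ∈ ascents x n) :
    parent^[n] (g • x) = x := by
  induction n generalizing x g with
  | zero =>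
    rw [ascents_zero] at h
    rw [h, one_smul]
    rfl
  | succ n ih =>
    obtain ⟨l, j, hj, g, hg, rfl⟩ := mem_ascents_succ.1 h
    rw [mul_smul, Function.iterate_succ_apply', ih hg, parent_letter_smul hj]

/-- If the products agreed, going up `n` parents from the common end point would identify the two
children, leaving only the double edge. -/
theorem mul_letter_ne {x : Vertex} {n : ℕ} {l l' : Fin 4} {j j' : Fin 5} {g g' : F}
    (hl : nextType (vertexType x) l = some j) (hl' : nextType (vertexType x) l' = some j')
    (hg : g ∈ ascents (letter l • x) n) (hg' : g' ∈ ascents (letter l' • x) n) (hne : l ≠ l') :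
    g * letter l ≠ g' * letter l' := by
  have key : ∀ (x x' : Vertex) (g g' : F), vertexType x = 4 → g ∈ ascents x n →
      g' ∈ ascents x' n → g * a⁻¹ ≠ g' * b⁻¹ := by
    intro x x' g g' hx hg hg' he
    -- Test on a grey vertex `y`: `a⁻¹` ascends to type 3, whence `g` ascends further to `depth y +
    -- 1 + n`. Since `b⁻¹` does not ascend at `y`, the other product reaches depth at most `depth y
    -- + n`.
    obtain ⟨y, hy⟩ := exists_vertexType 2
    have h2 : nextType (vertexType y) 2 = some 3 := by rw [hy]; rfl
    have h3 : nextType (vertexType y) 3 = none := by rw [hy]; rfl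
    have e := (mem_ascents_iff.1 (ascents_subset n
      (Or.inr ⟨hx, vertexType_letter_smul h2⟩) hg)).2
    rw [depth_letter_smul h2] at e
    obtain ⟨u, hu, hn, -⟩ := hg'
    have e' := depth_smul_le hu (letter 3 • y)
    have e'' := depth_letter_smul_le_of_none h3
    have : g • letter 2 • y = g' • letter 3 • y := by
      rw [← mul_smul, ← mul_smul]
      exact congrArg (· • y) he
    rw [this] at e
    lia
  intro he
  have hp : letter l • x = letter l' • x := by
    rw [← iterate_parent_smul hg, ← iterate_parent_smul hg', ← mul_smul, ← mul_smul, he]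
  obtain ⟨⟨rfl, rfl⟩ | ⟨rfl, rfl⟩, rfl, rfl⟩ := eq_or_of_letter_smul_eq hl hl' hne hp
  · exact key _ _ _ _ (vertexType_letter_smul hl) hg hg' he
  · exact key _ _ _ _ (vertexType_letter_smul hl') hg' hg he.symm

theorem isWordFor_unique {x : Vertex} {n : ℕ} {g : F} (h : g ∈ ascents x n) :
    ∃! u : List F, IsWordFor gens u g ∧ u.length = n := by
  obtain ⟨u, hu, hn, -⟩ := id h
  refine ⟨u, ⟨hu, hn⟩, fun v ⟨hv, hvn⟩ => ?_⟩
  induction n generalizing x g u v with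
  | zero => rw [List.length_eq_zero_iff.1 hn, List.length_eq_zero_iff.1 hvn]
  | succ n ih =>
    have hd := (mem_ascents_iff.1 h).2
    obtain ⟨u, g, l, hu', hun', rfl, rfl⟩ := exists_append_of_isWordFor hu hn
    obtain ⟨v, g', l', hv', hvn', rfl, he⟩ := exists_append_of_isWordFor hv hvn
    -- Any word of length `n + 1` that raises the depth by `n + 1` ascends at each letter, so the
    -- competing word is ascending too.
    have hup : ∀ (u : List F) (g : F) (l : Fin 4), IsWordFor gens u g → u.length = n →
        depth ((g * letter l) • x) = depth x + (n + 1) →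
        (∃ j, nextType (vertexType x) l = some j) ∧ g ∈ ascents (letter l • x) n := by
      intro u g l hu hn hd
      have h1 := depth_smul_le hu (letter l • x)
      have h2 := depth_letter_smul_le x l
      rw [mul_smul] at hd
      exact ⟨depth_letter_smul_iff.1 (by lia), u, hu, hn, by lia⟩
    obtain ⟨⟨j, hj⟩, hg⟩ := hup u g l hu' hun' hd
    obtain ⟨⟨j', hj'⟩, hg'⟩ := hup v g' l' hv' hvn' (by rw [← he]; exact hd)
    by_cases hll : l = l'
    · subst hll
      obtain rfl := mul_right_cancel he
      rw [ih hg u hu' hun' v ⟨hv', hvn'⟩ hv' hvn']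
    · exact absurd he (mul_letter_ne hj hj' hg hg' hll)

end Thompson

/-! ## Counting geodesics and their end points -/

namespace Thompson

theorem ascents_succ (x : Vertex) (n : ℕ) : ascents x (n + 1) =
    ⋃ l, {g | (nextType (vertexType x) l).isSome ∧ ∃ h ∈ ascents (letter l • x) n,
      h * letter l = g} := by
  ext g
  simp only [mem_ascents_succ, Set.mem_iUnion, Set.mem_ofPred_eq, Option.isSome_iff_exists,
    exists_and_right]

theorem finite_ascents (x : Vertex) (n : ℕ) : (ascents x n).Finite := by
  induction n generalizing x with
  | zero => rw [ascents_zero]; exact Set.finite_singleton 1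
  | succ n ih =>
    rw [ascents_succ]
    exact Set.finite_iUnion fun l => ((ih (letter l • x)).image (· * letter l)).subset fun g hg => hg.2

/-! ### Recurrences in the group ring and for numbers of geodesics -/

theorem coneSum_eq {x y : Vertex} (h : vertexType x = vertexType y) (n : ℕ) :
    coneSum gens basePt x n = coneSum gens basePt y n := by
  rw [coneSum, coneSum, coneLevel_eq, coneLevel_eq, ascents_eq h]

theorem coneSum_zero (x : Vertex) : coneSum gens basePt x 0 = 1 := by
  rw [coneSum, coneLevel_eq, ascents_zero, finsum_mem_singleton, map_one]

/-- The level splits by its rightmost letter; `mul_letter_ne` makes the pieces disjoint, and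
finiteness makes the `finsum` additive. -/
theorem coneSum_succ (x : Fin 5 → Vertex) (hx : ∀ i, vertexType (x i) = i) (i : Fin 5) (n : ℕ) :
    coneSum gens basePt (x i) (n + 1) =
      ∑ l, (nextType i l).elim 0 fun j => coneSum gens basePt (x j) n * ofF (letter l) := by
  rw [coneSum, coneLevel_eq, ascents_succ, hx, finsum_mem_iUnion, finsum_eq_sum_of_fintype]
  · refine Finset.sum_congr rfl fun l _ => ?_
    rcases h : nextType i l with _ | j
    · simp
    · have hj : vertexType (letter l • x i) = vertexType (x j) := by
        rw [hx, vertexType_letter_smul (by rw [hx, h])]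
      simp only [Option.isSome_some, true_and, Option.elim_some]
      rw [← coneSum_eq hj, coneSum, coneLevel_eq]
      have := AddMonoidHom.map_finsum_mem (fun g => ofF g)
        (AddMonoidHom.mulRight (ofF (letter l))) (finite_ascents (letter l • x i) n)
      rw [AddMonoidHom.coe_mulRight] at this
      refine Eq.trans ?_ this.symm
      refine (finsum_mem_image (g := (· * letter l)) (mul_left_injective _).injOn).trans ?_
      simp only [ofF, map_mul]
  · intro l l' hll
    rw [Function.onFun, Set.disjoint_left]
    rintro _ ⟨hl, g, hg, rfl⟩ ⟨hl', g', hg', he⟩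
    obtain ⟨j, hj⟩ := Option.isSome_iff_exists.1 hl
    obtain ⟨j', hj'⟩ := Option.isSome_iff_exists.1 hl'
    rw [← hx i] at hj hj'
    exact mul_letter_ne hj hj' hg hg' hll he.symm
  · exact fun l => ((finite_ascents (letter l • x i) n).image (· * letter l)).subset
      fun g hg => hg.2

theorem coneSum_recurrence (x : Fin 5 → Vertex) (hx : ∀ i, vertexType (x i) = i)
    (Λ : Fin 5 → ℕ → MonoidAlgebra ℤ F) (hΛ : ∀ i n, Λ i n = coneSum gens basePt (x i) n) (n : ℕ) :
    Λ 0 (n + 1) = Λ 1 n * ofF a + Λ 3 n * ofF a⁻¹ ∧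
    Λ 1 (n + 1) = Λ 1 n * ofF a ∧
    Λ 2 (n + 1) = Λ 1 n * ofF a + Λ 2 n * ofF b + Λ 3 n * ofF a⁻¹ ∧
    Λ 3 (n + 1) = Λ 2 n * ofF b + Λ 4 n * (ofF a⁻¹ + ofF b⁻¹) ∧
    Λ 4 (n + 1) = Λ 4 n * (ofF a⁻¹ + ofF b⁻¹) := by
  simp only [hΛ, coneSum_succ x hx, Fin.sum_univ_four, mul_add]
  simp [nextType, letter, add_assoc]

/-- The augmentation of the group ring turns the recurrences for sums into recurrences for
cardinalities. -/
theorem lift_one_coneSum (x : Vertex) (n : ℕ) :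
    MonoidAlgebra.lift ℤ ℤ F 1 (coneSum gens basePt x n) =
      ((coneLevel gens basePt x n).ncard : ℤ) := by
  have hf : (coneLevel gens basePt x n).Finite := by rw [coneLevel_eq]; exact finite_ascents x n
  rw [coneSum, finsum_mem_eq_finite_toFinset_sum _ hf, map_sum, Set.ncard_eq_toFinset_card _ hf]
  simp

theorem ncard_coneLevel_recurrence (x : Fin 5 → Vertex) (hx : ∀ i, vertexType (x i) = i)
    (N : Fin 5 → ℕ → ℕ) (hN : ∀ i n, N i n = (coneLevel gens basePt (x i) n).ncard) (n : ℕ) :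
    N 0 (n + 1) = N 1 n + N 3 n ∧ N 1 (n + 1) = N 1 n ∧
    N 2 (n + 1) = N 1 n + N 2 n + N 3 n ∧ N 3 (n + 1) = N 2 n + 2 * N 4 n ∧
    N 4 (n + 1) = 2 * N 4 n := by
  have hc : ∀ i n, (N i n : ℤ) = MonoidAlgebra.lift ℤ ℤ F 1 (coneSum gens basePt (x i) n) :=
    fun i n => by rw [hN, lift_one_coneSum]
  obtain ⟨h0, h1, h2, h3, h4⟩ := coneSum_recurrence x hx _ (fun _ _ => rfl) n
  zify
  simp only [hc]
  rw [h0, h1, h2, h3, h4]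
  simp only [map_add, map_mul, ofF, MonoidAlgebra.lift_of, MonoidHom.one_apply]
  refine ⟨by ring, by ring, by ring, by ring, by ring⟩

/-! ### End points of geodesic continuations -/

/-- The end points of the geodesic continuations of length `n` from `x`. -/
def descendants (x : Vertex) (n : ℕ) : Set Vertex := {y | ∃ g ∈ ascents x n, g • x = y}

theorem coneOrbitCount_eq (x : Vertex) (n : ℕ) :
    coneOrbitCount gens basePt x n = (descendants x n).ncard := by
  rw [coneOrbitCount, coneLevel_eq]
  rfl

theorem descendants_zero (x : Vertex) : descendants x 0 = {x} := by
  ext y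
  simp [descendants, ascents_zero, eq_comm]

theorem finite_descendants (x : Vertex) (n : ℕ) : (descendants x n).Finite :=
  (finite_ascents x n).image (· • x)

theorem mem_descendants_succ {x y : Vertex} {n : ℕ} : y ∈ descendants x (n + 1) ↔
    ∃ l j, nextType (vertexType x) l = some j ∧ y ∈ descendants (letter l • x) n := by
  constructor
  · rintro ⟨g, hg, rfl⟩
    obtain ⟨l, j, hj, g, hg', rfl⟩ := mem_ascents_succ.1 hg
    exact ⟨l, j, hj, g, hg', (mul_smul _ _ _).symm⟩
  · rintro ⟨l, j, hj, g, hg, rfl⟩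
    exact ⟨_, mem_ascents_succ.2 ⟨l, j, hj, g, hg, rfl⟩, mul_smul _ _ _⟩

theorem disjoint_descendants {x y : Vertex} (h : x ≠ y) (n : ℕ) :
    Disjoint (descendants x n) (descendants y n) := by
  rw [Set.disjoint_left]
  rintro _ ⟨g, hg, rfl⟩ ⟨g', hg', he⟩
  exact h (by rw [← iterate_parent_smul hg, ← he, iterate_parent_smul hg'])

theorem descendants_basePt (n : ℕ) : descendants basePt n = {y | depth y = n} := by
  ext y
  constructor
  · rintro ⟨g, hg, rfl⟩
    have := (mem_ascents_iff.1 hg).2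
    rwa [depth_eq_zero_iff.2 rfl, zero_add] at this
  · rintro rfl
    exact exists_mem_ascents_smul_eq y

/-- The number of end points of geodesic continuations of length `n` from a vertex of type `i`. -/
def endpointCount : ℕ → Fin 5 → ℕ
  | 0 => fun _ => 1
  | n + 1 => ![endpointCount n 1 + endpointCount n 3, endpointCount n 1,
      endpointCount n 1 + endpointCount n 2 + endpointCount n 3,
      endpointCount n 2 + endpointCount n 4, endpointCount n 4]

theorem ncard_descendants (x : Vertex) (n : ℕ) :
    (descendants x n).ncard = endpointCount n (vertexType x) := by
  induction n generalizing x with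
  | zero => rw [descendants_zero, Set.ncard_singleton]; rfl
  | succ n ih =>
    have hmem := fun y => mem_descendants_succ (x := x) (y := y) (n := n)
    have ht := fun l j => vertexType_letter_smul (x := x) (l := l) (j := j)
    have hfin := fun l => finite_descendants (letter l • x) n
    have hdis : ∀ l l' j j', nextType (vertexType x) l = some j →
        nextType (vertexType x) l' = some j' → j ≠ j' →
        Disjoint (descendants (letter l • x) n) (descendants (letter l' • x) n) := by
      intro l l' j j' h h' hne
      refine disjoint_descendants (fun he => hne ?_) n
      rw [← ht l j h, ← ht l' j' h', he]
    -- For types 3 and 4 the two letters of the double edge contribute the same set of end points,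
    -- counted once.
    have h34 : vertexType x = 3 ∨ vertexType x = 4 → letter 3 • x = letter 2 • x := fun h =>
      b_inv_smul_eq_a_inv_smul <| h.elim (fun h => (vertexType_eq_three.1 h).1)
        fun h => by linarith [vertexType_eq_four.1 h]
    generalize hi : vertexType x = i at hmem ht hdis h34
    fin_cases i
    · have e : descendants x (n + 1) =
          descendants (letter 0 • x) n ∪ descendants (letter 2 • x) n := by
        ext y
        rw [hmem]
        simp [Fin.exists_fin_succ, nextType]
      rw [e, Set.ncard_union_eq (hdis 0 2 1 3 rfl rfl (by decide)) (hfin _) (hfin _), ih, ih,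
        ht 0 1 rfl, ht 2 3 rfl]
      rfl
    · have e : descendants x (n + 1) = descendants (letter 0 • x) n := by
        ext y
        rw [hmem]
        simp [Fin.exists_fin_succ, nextType]
      rw [e, ih, ht 0 1 rfl]
      rfl
    · have e : descendants x (n + 1) = descendants (letter 0 • x) n ∪
          descendants (letter 1 • x) n ∪ descendants (letter 2 • x) n := by
        ext y
        rw [hmem]
        simp [Fin.exists_fin_succ, nextType, or_assoc]
      rw [e, Set.ncard_union_eq (Set.disjoint_union_left.2
        ⟨hdis 0 2 1 3 rfl rfl (by decide), hdis 1 2 2 3 rfl rfl (by decide)⟩)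
        ((hfin _).union (hfin _)) (hfin _),
        Set.ncard_union_eq (hdis 0 1 1 2 rfl rfl (by decide)) (hfin _) (hfin _), ih, ih, ih,
        ht 0 1 rfl, ht 1 2 rfl, ht 2 3 rfl]
      rfl
    · have e : descendants x (n + 1) =
          descendants (letter 1 • x) n ∪ descendants (letter 2 • x) n := by
        ext y
        rw [hmem]
        simp [Fin.exists_fin_succ, nextType]
        simp [h34 (Or.inl rfl)]
      rw [e, Set.ncard_union_eq (hdis 1 2 2 4 rfl rfl (by decide)) (hfin _) (hfin _), ih, ih,
        ht 1 2 rfl, ht 2 4 rfl]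
      rfl
    · have e : descendants x (n + 1) = descendants (letter 2 • x) n := by
        ext y
        rw [hmem]
        simp [Fin.exists_fin_succ, nextType]
        simp [h34 (Or.inr rfl)]
      rw [e, ih, ht 2 4 rfl]
      rfl

/-- The shifts by 1 and 2 absorb the constant contributions of types 1 and 4, turning the system
into the Fibonacci recursion. -/
theorem endpointCount_eq_fib (n : ℕ) : endpointCount n 1 = 1 ∧ endpointCount n 4 = 1 ∧
    endpointCount n 3 + 1 = Nat.fib (n + 3) ∧ endpointCount n 2 + 2 = Nat.fib (n + 4) ∧
    endpointCount n 0 = Nat.fib (n + 2) := by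
  induction n with
  | zero => simp [endpointCount, Nat.fib]
  | succ n ih =>
    obtain ⟨h1, h4, h3, h2, -⟩ := ih
    have e1 : Nat.fib (n + 5) = Nat.fib (n + 3) + Nat.fib (n + 4) := Nat.fib_add_two
    refine ⟨h1, h4, ?_, ?_, ?_⟩
    · change endpointCount n 2 + endpointCount n 4 + 1 = Nat.fib (n + 4)
      lia
    · change endpointCount n 1 + endpointCount n 2 + endpointCount n 3 + 2 = Nat.fib (n + 5)
      lia
    · change endpointCount n 1 + endpointCount n 3 = Nat.fib (n + 3)
      lia

/-! ### Spheres and balls -/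

theorem graphSphere_eq (n : ℕ) : graphSphere graphH basePt n = descendants basePt n := by
  rw [descendants_basePt]
  ext y
  change graphH.edist basePt y = n ↔ depth y = n
  rw [edist_basePt]
  norm_cast

theorem ncard_graphSphere (n : ℕ) : (graphSphere graphH basePt n).ncard = Nat.fib (n + 2) := by
  rw [graphSphere_eq, ncard_descendants, vertexType_eq_zero.2 val_basePt]
  exact (endpointCount_eq_fib n).2.2.2.2

theorem mem_graphBall {n : ℕ} {y : Vertex} : y ∈ graphBall graphH basePt n ↔ depth y ≤ n := by
  change graphH.edist basePt y ≤ n ↔ depth y ≤ n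
  rw [edist_basePt]
  norm_cast

theorem graphBall_zero : graphBall graphH basePt 0 = {basePt} := by
  ext y
  rw [mem_graphBall, Nat.le_zero, depth_eq_zero_iff]
  rfl

theorem graphBall_succ (n : ℕ) : graphBall graphH basePt (n + 1) =
    graphBall graphH basePt n ∪ descendants basePt (n + 1) := by
  ext y
  rw [descendants_basePt, Set.mem_union, mem_graphBall, mem_graphBall, Nat.le_succ_iff]
  rfl

theorem finite_graphBall (n : ℕ) : (graphBall graphH basePt n).Finite := by
  induction n with
  | zero => rw [graphBall_zero]; exact Set.finite_singleton _
  | succ n ih => rw [graphBall_succ]; exact ih.union (finite_descendants _ _)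

theorem ncard_graphBall_succ (n : ℕ) : (graphBall graphH basePt (n + 1)).ncard =
    (graphBall graphH basePt n).ncard + Nat.fib (n + 3) := by
  rw [graphBall_succ, Set.ncard_union_eq _ (finite_graphBall n) (finite_descendants _ _),
    ← graphSphere_eq, ncard_graphSphere]
  rw [Set.disjoint_left, descendants_basePt]
  intro y hy hy'
  rw [mem_graphBall, hy'] at hy
  lia

end Thompson

/-! ## Growth series -/

section Series

open PowerSeries Matrix

/-- The inverse is the geometric series `P` with coefficients `M ^ k`. The ring need not be
commutative, so determinants are unavailable and both products are checked, using that `X` is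
central. -/
theorem isUnit_one_sub_X_smul_map_C {R n : Type*} [Ring R] [Fintype n] [DecidableEq n]
    (M : Matrix n n R) : IsUnit (1 - (X : PowerSeries R) • M.map C) := by
  set P : Matrix n n (PowerSeries R) := Matrix.of fun i j => PowerSeries.mk fun k => (M ^ k) i j
    with hP
  have h1 : (X : PowerSeries R) • (M.map C * P) = P - 1 := by
    ext i j k
    rw [Matrix.smul_apply, smul_eq_mul, Matrix.sub_apply, Matrix.mul_apply, map_sub]
    rcases k with _ | k
    · rw [coeff_zero_X_mul]
      by_cases hij : i = j <;> simp [hP, Matrix.one_apply, hij]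
    · rw [coeff_succ_X_mul, map_sum]
      simp only [hP, Matrix.map_apply, coeff_C_mul, Matrix.of_apply, coeff_mk, pow_succ',
        Matrix.mul_apply]
      by_cases hij : i = j <;> simp [Matrix.one_apply, hij, coeff_one]
  have h2 : (P * (X : PowerSeries R) • M.map C) = P - 1 := by
    ext i j k
    rw [Matrix.sub_apply, Matrix.mul_apply, map_sub, map_sum]
    simp only [Matrix.smul_apply, smul_eq_mul, Matrix.map_apply]
    rcases k with _ | k
    · by_cases hij : i = j <;> simp [hP, Matrix.one_apply, hij]
    · simp only [hP, X_mul, ← mul_assoc, coeff_succ_mul_X, coeff_mul_C, Matrix.of_apply, coeff_mk,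
        pow_succ, Matrix.mul_apply]
      by_cases hij : i = j <;> simp [Matrix.one_apply, hij, coeff_one]
  refine ⟨⟨1 - (X : PowerSeries R) • M.map C, P, ?_, ?_⟩, rfl⟩
  · rw [sub_mul, one_mul, Matrix.smul_mul, h1, sub_sub_cancel]
  · rw [mul_sub, mul_one, h2, sub_sub_cancel]

theorem vecMul_one_sub_X_smul_map_C_transpose {R n : Type*} [Ring R] [Fintype n] [DecidableEq n]
    (M : Matrix n n R) (v : n → ℕ → R) (h0 : ∀ i, v i 0 = 1)
    (hs : ∀ i k, v i (k + 1) = ∑ j, v j k * M i j) :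
    Matrix.vecMul (fun i => PowerSeries.mk (v i)) (1 - (X : PowerSeries R) • (M.map C)ᵀ) = 1 := by
  rw [Matrix.vecMul_sub, Matrix.vecMul_one]
  ext i k
  rw [Pi.sub_apply, map_sub, Matrix.vecMul, dotProduct, map_sum]
  simp only [Matrix.smul_apply, smul_eq_mul, Matrix.transpose_apply, Matrix.map_apply,
    Pi.one_apply, coeff_mk]
  rcases k with _ | k
  · simp [h0]
  · simp only [X_mul, ← mul_assoc, coeff_succ_mul_X, coeff_mul_C, coeff_mk, hs]
    simp [coeff_one]

theorem eq_inv_mulVec_one {n : Type*} [Fintype n] [DecidableEq n]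
    {M : Matrix n n (PowerSeries ℝ)} {v : n → PowerSeries ℝ}
    (h : v = 1 + (X : PowerSeries ℝ) • M *ᵥ v) :
    v = (1 - (X : PowerSeries ℝ) • M)⁻¹ *ᵥ 1 := by
  have hu : IsUnit (1 - (X : PowerSeries ℝ) • M).det := by
    rw [PowerSeries.isUnit_iff_constantCoeff, RingHom.map_det]
    -- At `X = 0` the matrix becomes the identity, so its determinant has constant coefficient 1.
    have : (constantCoeff (R := ℝ)).mapMatrix (1 - (X : PowerSeries ℝ) • M) = 1 := by
      rw [map_sub, map_one]
      ext i j
      simp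
    rw [this, det_one]
    exact isUnit_one
  have h' : (1 - (X : PowerSeries ℝ) • M) *ᵥ v = 1 := by
    rw [Matrix.sub_mulVec, Matrix.one_mulVec, Matrix.smul_mulVec, sub_eq_iff_eq_add]
    exact h
  rw [← h', Matrix.mulVec_mulVec, Matrix.nonsing_inv_mul _ hu, Matrix.one_mulVec]

theorem mk_eq_one_add_X_mul {f : ℕ → ℝ} (h0 : f 0 = 1) :
    PowerSeries.mk f = 1 + X * PowerSeries.mk fun n => f (n + 1) := by
  ext n
  rcases n with _ | n
  · simp [h0]
  · simp [coeff_succ_X_mul, coeff_one]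

theorem mk_pow_eq_inv (r : ℝ) : (PowerSeries.mk fun n => r ^ n) = (1 - C r * X)⁻¹ := by
  rw [PowerSeries.eq_inv_iff_mul_eq_one (by simp)]
  ext n
  rw [mul_sub, mul_one, map_sub, ← mul_assoc]
  rcases n with _ | n
  · simp
  · rw [coeff_succ_mul_X, coeff_mul_C]
    simp [coeff_one, pow_succ]

theorem ne_zero_of_constantCoeff_eq_one {f : PowerSeries ℝ} (h : constantCoeff f = 1) : f ≠ 0 := by
  rintro rfl
  simp at h

/-- The common part of the two systems of linear equations for the growth series. -/
theorem growth_equations {N : Fin 5 → ℕ → ℕ} (c : ℕ) (h0 : ∀ i, N i 0 = 1)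
    (hs : ∀ n, N 0 (n + 1) = N 1 n + N 3 n ∧ N 1 (n + 1) = N 1 n ∧
      N 2 (n + 1) = N 1 n + N 2 n + N 3 n ∧ N 3 (n + 1) = N 2 n + c * N 4 n ∧
      N 4 (n + 1) = c * N 4 n) {v : Fin 5 → PowerSeries ℝ}
    (hv : v = fun i => PowerSeries.mk fun n => (N i n : ℝ)) :
    v 0 = 1 + X * (v 1 + v 3) ∧ v 1 = 1 + X * v 1 ∧ v 2 = 1 + X * (v 1 + v 2 + v 3) ∧
      v 3 = 1 + X * (v 2 + C (c : ℝ) * v 4) ∧ v 4 = 1 + X * (C (c : ℝ) * v 4) := by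
  have h : ∀ i, v i = 1 + X * PowerSeries.mk fun n => (N i (n + 1) : ℝ) := fun i => by
    rw [hv]
    exact mk_eq_one_add_X_mul (by simp [h0])
  have hv' : ∀ i, v i = PowerSeries.mk fun n => (N i n : ℝ) := fun i => by rw [hv]
  refine ⟨(h 0).trans ?_, (h 1).trans ?_, (h 2).trans ?_, (h 3).trans ?_, (h 4).trans ?_⟩ <;>
    congr 2 <;> simp only [hv'] <;> ext n <;> simp [hs n, -map_natCast, coeff_C_mul]

theorem geodesic_series {v : Fin 5 → PowerSeries ℝ} (h0 : v 0 = 1 + X * (v 1 + v 3))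
    (h1 : v 1 = 1 + X * v 1) (h2 : v 2 = 1 + X * (v 1 + v 2 + v 3))
    (h3 : v 3 = 1 + X * (v 2 + 2 * v 4)) (h4 : v 4 = 1 + X * (2 * v 4)) :
    v = ![(1 - 2 * X : PowerSeries ℝ)⁻¹, (1 - X)⁻¹, (1 - 3 * X + 2 * X ^ 2)⁻¹,
          (1 - 3 * X + 2 * X ^ 2)⁻¹, (1 - 2 * X)⁻¹] := by
  have e1 : v 1 * (1 - X) = 1 := by linear_combination h1
  have e4 : v 4 * (1 - 2 * X) = 1 := by linear_combination h4
  have e2 : v 2 * (1 - 3 * X + 2 * X ^ 2) = 1 := by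
    -- Eliminating `v 3` leaves the factor `1 - X - X ^ 2` on `v 2`. After multiplication by `(1 -
    -- X) * (1 - 2 * X)` it also appears on the right and cancels.
    refine mul_left_cancel₀ (ne_zero_of_constantCoeff_eq_one
      (by simp : constantCoeff (1 - X - X ^ 2 : PowerSeries ℝ) = 1)) ?_
    linear_combination (1 - 3 * X + 2 * X ^ 2) * (h2 + X * h3) + X * (1 - 2 * X) * e1 +
      2 * X ^ 2 * (1 - X) * e4
  have e3 : v 3 * (1 - 3 * X + 2 * X ^ 2) = 1 := by
    linear_combination (1 - 3 * X + 2 * X ^ 2) * h3 + X * e2 + 2 * X * (1 - X) * e4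
  have e0 : v 0 * (1 - 2 * X) = 1 := by
    refine mul_left_cancel₀ (ne_zero_of_constantCoeff_eq_one
      (by simp : constantCoeff (1 - X : PowerSeries ℝ) = 1)) ?_
    linear_combination (1 - 3 * X + 2 * X ^ 2) * h0 + X * (1 - 2 * X) * e1 + X * e3
  ext1 i
  fin_cases i
  · exact (PowerSeries.eq_inv_iff_mul_eq_one (by simp)).2 e0
  · exact (PowerSeries.eq_inv_iff_mul_eq_one (by simp)).2 e1
  · exact (PowerSeries.eq_inv_iff_mul_eq_one (by simp)).2 e2
  · exact (PowerSeries.eq_inv_iff_mul_eq_one (by simp)).2 e3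
  · exact (PowerSeries.eq_inv_iff_mul_eq_one (by simp)).2 e4

theorem endpoint_series {v : Fin 5 → PowerSeries ℝ} (h0 : v 0 = 1 + X * (v 1 + v 3))
    (h1 : v 1 = 1 + X * v 1) (h2 : v 2 = 1 + X * (v 1 + v 2 + v 3))
    (h3 : v 3 = 1 + X * (v 2 + v 4)) (h4 : v 4 = 1 + X * v 4) :
    v = ![(1 + X) * (1 - X - X ^ 2 : PowerSeries ℝ)⁻¹, (1 - X)⁻¹,
          (1 + X) * (1 - 2 * X + X ^ 3)⁻¹, (1 - 2 * X + X ^ 3)⁻¹, (1 - X)⁻¹] := by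
  have e1 : v 1 * (1 - X) = 1 := by linear_combination h1
  have e4 : v 4 * (1 - X) = 1 := by linear_combination h4
  have e2 : v 2 * (1 - 2 * X + X ^ 3) = 1 + X := by
    -- Here `(1 - X) * (1 - X - X ^ 2) = 1 - 2 * X + X ^ 3`: the first factor clears `v 1` and `v
    -- 4`, the second comes from eliminating `v 3`.
    linear_combination (1 - X) * (h2 + X * h3) + X * e1 + X ^ 2 * e4
  have e3 : v 3 * (1 - 2 * X + X ^ 3) = 1 := by
    linear_combination (1 - 2 * X + X ^ 3) * h3 + X * e2 + X * (1 - X - X ^ 2) * e4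
  have e0 : v 0 * (1 - X - X ^ 2) = 1 + X := by
    refine mul_left_cancel₀ (ne_zero_of_constantCoeff_eq_one
      (by simp : constantCoeff (1 - X : PowerSeries ℝ) = 1)) ?_
    linear_combination (1 - 2 * X + X ^ 3) * h0 + X * (1 - X - X ^ 2) * e1 + X * e3
  ext1 i
  fin_cases i
  · exact (PowerSeries.eq_mul_inv_iff_mul_eq (by simp)).2 e0
  · exact (PowerSeries.eq_inv_iff_mul_eq_one (by simp)).2 e1
  · exact (PowerSeries.eq_mul_inv_iff_mul_eq (by simp)).2 e2
  · exact (PowerSeries.eq_inv_iff_mul_eq_one (by simp)).2 e3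
  · exact (PowerSeries.eq_inv_iff_mul_eq_one (by simp)).2 e4

end Series

/-! ### Growth series of the Schreier graph -/

namespace Thompson

open PowerSeries Real

theorem ncard_coneLevel_zero (x : Vertex) : (coneLevel gens basePt x 0).ncard = 1 := by
  rw [coneLevel_eq, ascents_zero, Set.ncard_singleton]

theorem geodesic_growth_equations (x : Fin 5 → Vertex) (hx : ∀ i, vertexType (x i) = i)
    {v : Fin 5 → PowerSeries ℝ}
    (hv : v = fun i => PowerSeries.mk fun n => ((coneLevel gens basePt (x i) n).ncard : ℝ)) :
    v 0 = 1 + X * (v 1 + v 3) ∧ v 1 = 1 + X * v 1 ∧ v 2 = 1 + X * (v 1 + v 2 + v 3) ∧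
      v 3 = 1 + X * (v 2 + 2 * v 4) ∧ v 4 = 1 + X * (2 * v 4) := by
  have h := growth_equations (N := fun i n => (coneLevel gens basePt (x i) n).ncard) 2
    (fun i => ncard_coneLevel_zero (x i))
    (ncard_coneLevel_recurrence x hx _ fun _ _ => rfl) hv
  have hC : C ((2 : ℕ) : ℝ) = 2 := by rw [map_natCast, Nat.cast_ofNat]
  rwa [hC] at h

theorem endpoint_growth_equations {v : Fin 5 → PowerSeries ℝ}
    (hv : v = fun i => PowerSeries.mk fun n => (endpointCount n i : ℝ)) :
    v 0 = 1 + X * (v 1 + v 3) ∧ v 1 = 1 + X * v 1 ∧ v 2 = 1 + X * (v 1 + v 2 + v 3) ∧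
      v 3 = 1 + X * (v 2 + v 4) ∧ v 4 = 1 + X * v 4 := by
  have h := growth_equations (N := fun i n => endpointCount n i) 1 (fun i => rfl)
    (fun n => by simp [endpointCount]) hv
  simpa using h

theorem setOf_isGeodesicOfLength (n : ℕ) :
    {g : F | IsGeodesicOfLength gens basePt g n} = ascents basePt n :=
  Set.ext fun _ => isGeodesicOfLength_iff

theorem geodesicGrowth_eq : geodesicGrowth gens basePt = (1 - 2 * X : PowerSeries ℝ)⁻¹ := by
  choose x hx using exists_vertexType
  obtain ⟨v, hv⟩ : ∃ v : Fin 5 → PowerSeries ℝ,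
    v = fun i => PowerSeries.mk fun n => ((coneLevel gens basePt (x i) n).ncard : ℝ) := ⟨_, rfl⟩
  obtain ⟨h0, h1, h2, h3, h4⟩ := geodesic_growth_equations x hx hv
  have h := congrFun (geodesic_series h0 h1 h2 h3 h4) 0
  rw [hv] at h
  refine Eq.trans ?_ h
  have h0 : x 0 = basePt := Vertex.eq_basePt_iff.2 (vertexType_eq_zero.1 (hx 0))
  rw [geodesicGrowth]
  congr 1
  ext n
  rw [h0, coneLevel_eq, setOf_isGeodesicOfLength]

theorem orbitGrowth_eq_mk_fib :
    orbitGrowth gens basePt = PowerSeries.mk fun n => (Nat.fib (n + 2) : ℝ) := by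
  rw [orbitGrowth]
  congr 1
  ext n
  simp_rw [isGeodesicOfLength_iff]
  change ((descendants basePt n).ncard : ℝ) = _
  rw [← graphSphere_eq, ncard_graphSphere]

theorem orbitGrowth_eq :
    orbitGrowth gens basePt = (1 + X) * (1 - X - X ^ 2 : PowerSeries ℝ)⁻¹ := by
  obtain ⟨v, hv⟩ : ∃ v : Fin 5 → PowerSeries ℝ,
    v = fun i => PowerSeries.mk fun n => (endpointCount n i : ℝ) := ⟨_, rfl⟩
  obtain ⟨h0, h1, h2, h3, h4⟩ := endpoint_growth_equations hv
  have h := congrFun (endpoint_series h0 h1 h2 h3 h4) 0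
  rw [hv] at h
  rw [orbitGrowth_eq_mk_fib]
  refine Eq.trans ?_ h
  congr 1
  ext n
  rw [(endpointCount_eq_fib n).2.2.2.2]

theorem orbitGrowth_eq_goldenRatio : orbitGrowth gens basePt =
    C (goldenRatio ^ 2 / √5) * (1 - C goldenRatio * X)⁻¹ -
      C (goldenConj ^ 2 / √5) * (1 - C goldenConj * X)⁻¹ := by
  rw [orbitGrowth_eq_mk_fib, ← mk_pow_eq_inv, ← mk_pow_eq_inv]
  ext n
  rw [map_sub, coeff_C_mul, coeff_C_mul, coeff_mk, coeff_mk, coeff_mk, coe_fib_eq]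
  ring

theorem ncard_graphBall (n : ℕ) : ((graphBall graphH basePt n).ncard : ℝ) =
    (goldenRatio ^ (n + 3) - goldenRatio ^ 2) / (√5 * (goldenRatio - 1)) -
      (goldenConj ^ (n + 3) - goldenConj ^ 2) / (√5 * (goldenConj - 1)) := by
  have h5 : √5 ≠ 0 := by positivity
  have h1 : goldenRatio - 1 ≠ 0 := sub_ne_zero.2 one_lt_goldenRatio.ne'
  have h2 : goldenConj - 1 ≠ 0 := (sub_neg.2 (goldenConj_neg.trans one_pos)).ne
  have hfib := coe_fib_eq
  -- Only Binet's formula and `p, q ≠ 1` matter: the ball is a sum of spheres, hence a difference of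
  -- two geometric sums.
  generalize goldenRatio = p at *
  generalize goldenConj = q at *
  induction n with
  | zero =>
    have h := hfib 2
    rw [show Nat.fib 2 = 1 from rfl, Nat.cast_one] at h
    rw [graphBall_zero, Set.ncard_singleton, Nat.cast_one]
    refine h.trans ?_
    field_simp
    ring
  | succ n ih =>
    rw [ncard_graphBall_succ, Nat.cast_add, ih, hfib]
    field_simp
    ring

end Thompson

open Thompson PowerSeries Real in
theorem mainTheorem4 :
    -- the orbit of `1/2` consists of the dyadic numbers in the open interval `(0, 1)`
    (∀ t : Dyadics, t ∈ MulAction.orbit F half ↔ 0 < (t.1 : ℝ) ∧ (t.1 : ℝ) < 1) ∧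
    -- a geodesic is spelled by exactly one word of minimal length
    (∀ (g : F) (n : ℕ), IsGeodesicOfLength gens basePt g n →
      ∃! u : List F, IsWordFor gens u g ∧ u.length = n) ∧
    -- there are exactly five cone types
    (∀ x : Vertex, ∃! i : Fin 5, HasType x i) ∧
    (∀ i : Fin 5, ∃ x : Vertex, HasType x i) ∧
    (∀ (x y : Vertex) (i j : Fin 5), HasType x i → HasType y j →
      (coneType gens basePt x = coneType gens basePt y ↔ i = j)) ∧
    -- recurrences and generating functions for the five cone types
    (∀ x : Fin 5 → Vertex, (∀ i, HasType (x i) i) →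
      ∀ (Λ : Fin 5 → ℕ → MonoidAlgebra ℤ F) (L : Fin 5 → ℕ → ℕ),
      (∀ i n, Λ i n = coneSum gens basePt (x i) n) →
      (∀ i n, L i n = coneOrbitCount gens basePt (x i) n) →
      (∀ i, Λ i 0 = 1) ∧
      (∀ n,
        Λ 0 (n + 1) = Λ 1 n * ofF a + Λ 3 n * ofF a⁻¹ ∧
        Λ 1 (n + 1) = Λ 1 n * ofF a ∧
        Λ 2 (n + 1) = Λ 1 n * ofF a + Λ 2 n * ofF b + Λ 3 n * ofF a⁻¹ ∧
        Λ 3 (n + 1) = Λ 2 n * ofF b + Λ 4 n * (ofF a⁻¹ + ofF b⁻¹) ∧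
        Λ 4 (n + 1) = Λ 4 n * (ofF a⁻¹ + ofF b⁻¹)) ∧
      (∀ i, L i 0 = 1) ∧
      (∀ n,
        L 0 (n + 1) = L 1 n + L 3 n ∧
        L 1 (n + 1) = L 1 n ∧
        L 2 (n + 1) = L 1 n + L 2 n + L 3 n ∧
        L 3 (n + 1) = L 2 n + L 4 n ∧
        L 4 (n + 1) = L 4 n) ∧
      -- the extended complete geodesic growth function; coefficients multiply from the right
      (IsUnit (1 - (X : PowerSeries (MonoidAlgebra ℤ F)) • (matrixAbold.map C).transpose) ∧
        Matrix.vecMul (fun i => PowerSeries.mk (Λ i))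
          (1 - (X : PowerSeries (MonoidAlgebra ℤ F)) • (matrixAbold.map C).transpose) = 1) ∧
      completeGeodesicGrowth gens basePt = PowerSeries.mk (Λ 0) ∧
      -- the numbers of geodesics
      (fun i => PowerSeries.mk fun n => ((coneLevel gens basePt (x i) n).ncard : ℝ)) =
        (1 - (X : PowerSeries ℝ) • matrixA)⁻¹.mulVec 1 ∧
      (fun i => PowerSeries.mk fun n => ((coneLevel gens basePt (x i) n).ncard : ℝ)) =
        ![(1 - 2 * X : PowerSeries ℝ)⁻¹, (1 - X)⁻¹, (1 - 3 * X + 2 * X ^ 2)⁻¹,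
          (1 - 3 * X + 2 * X ^ 2)⁻¹, (1 - 2 * X)⁻¹] ∧
      -- the numbers of end points
      (fun i => PowerSeries.mk fun n => (L i n : ℝ)) =
        (1 - (X : PowerSeries ℝ) • matrixB)⁻¹.mulVec 1 ∧
      (fun i => PowerSeries.mk fun n => (L i n : ℝ)) =
        ![(1 + X) * (1 - X - X ^ 2 : PowerSeries ℝ)⁻¹, (1 - X)⁻¹,
          (1 + X) * (1 - 2 * X + X ^ 3)⁻¹, (1 - 2 * X + X ^ 3)⁻¹, (1 - X)⁻¹]) ∧
    -- geodesic growth and orbit growth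
    geodesicGrowth gens basePt = (1 - 2 * X : PowerSeries ℝ)⁻¹ ∧
    orbitGrowth gens basePt = (1 + X) * (1 - X - X ^ 2 : PowerSeries ℝ)⁻¹ ∧
    orbitGrowth gens basePt =
      C (goldenRatio ^ 2 / √5) * (1 - C goldenRatio * X)⁻¹ -
        C (goldenConj ^ 2 / √5) * (1 - C goldenConj * X)⁻¹ ∧
    -- spheres and balls
    (∀ n : ℕ, ((graphSphere graphH basePt n).ncard : ℝ) =
      (goldenRatio ^ (n + 2) - goldenConj ^ (n + 2)) / √5) ∧
    (∀ n : ℕ, ((graphBall graphH basePt n).ncard : ℝ) =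
      (goldenRatio ^ (n + 3) - goldenRatio ^ 2) / (√5 * (goldenRatio - 1)) -
        (goldenConj ^ (n + 3) - goldenConj ^ 2) / (√5 * (goldenConj - 1))) := by
  refine ⟨mem_orbit_half_iff, fun g n h => isWordFor_unique (isGeodesicOfLength_iff.1 h),
    fun x => ⟨vertexType x, hasType_iff.2 rfl, fun i hi => (hasType_iff.1 hi).symm⟩,
    fun i => (exists_vertexType i).imp fun x hx => hasType_iff.2 hx, ?_, ?_,
    geodesicGrowth_eq, orbitGrowth_eq, orbitGrowth_eq_goldenRatio,
    fun n => by rw [ncard_graphSphere, coe_fib_eq], ncard_graphBall⟩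
  · intro x y i j hi hj
    rw [coneType_eq_iff, hasType_iff.1 hi, hasType_iff.1 hj]
  intro x hx Λ L hΛ hL
  replace hx := fun i => hasType_iff.1 (hx i)
  have hL' : ∀ i n, L i n = endpointCount n i := fun i n => by
    rw [hL, coneOrbitCount_eq, ncard_descendants, hx]
  have hΛ0 : ∀ i, Λ i 0 = 1 := fun i => by rw [hΛ, coneSum_zero]
  have hΛs := coneSum_recurrence x hx Λ hΛ
  obtain ⟨g0, g1, g2, g3, g4⟩ := geodesic_growth_equations x hx rfl
  obtain ⟨e0, e1, e2, e3, e4⟩ := endpoint_growth_equations rfl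
  simp only [hL']
  refine ⟨hΛ0, hΛs, fun i => rfl, fun n => by simp [endpointCount], ⟨?_, ?_⟩, ?_, ?_,
    geodesic_series g0 g1 g2 g3 g4, ?_, endpoint_series e0 e1 e2 e3 e4⟩
  · exact isUnit_one_sub_X_smul_map_C matrixAbold.transpose
  · refine vecMul_one_sub_X_smul_map_C_transpose _ _ hΛ0 fun i n => ?_
    obtain ⟨s0, s1, s2, s3, s4⟩ := hΛs n
    fin_cases i
    · simpa [matrixAbold, Fin.sum_univ_five] using s0
    · simpa [matrixAbold, Fin.sum_univ_five] using s1
    · simpa [matrixAbold, Fin.sum_univ_five] using s2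
    · simpa [matrixAbold, Fin.sum_univ_five] using s3
    · simpa [matrixAbold, Fin.sum_univ_five] using s4
  · have h0 : x 0 = basePt := Vertex.eq_basePt_iff.2 (vertexType_eq_zero.1 (hx 0))
    rw [completeGeodesicGrowth]
    congr 1
    ext1 n
    rw [hΛ, coneSum, h0, coneLevel_eq, setOf_isGeodesicOfLength]
  · apply eq_inv_mulVec_one
    ext1 i
    fin_cases i
    · refine g0.trans ?_
      simp [matrixA, dotProduct, Fin.sum_univ_five]
    · refine g1.trans ?_
      simp [matrixA, dotProduct, Fin.sum_univ_five]
    · refine g2.trans ?_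
      simp [matrixA, dotProduct, Fin.sum_univ_five]
    · refine g3.trans ?_
      simp [matrixA, dotProduct, Fin.sum_univ_five]
    · refine g4.trans ?_
      simp [matrixA, dotProduct, Fin.sum_univ_five]
  · apply eq_inv_mulVec_one
    ext1 i
    fin_cases i
    · refine e0.trans ?_
      simp [matrixB, dotProduct, Fin.sum_univ_five]
    · refine e1.trans ?_
      simp [matrixB, dotProduct, Fin.sum_univ_five]
    · refine e2.trans ?_
      simp [matrixB, dotProduct, Fin.sum_univ_five]
    · refine e3.trans ?_
      simp [matrixB, dotProduct, Fin.sum_univ_five]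
    · refine e4.trans ?_
      simp [matrixB, dotProduct, Fin.sum_univ_five]
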